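/- A cone $K\subset\mathbb R^d$ is a closed set that is stable under addition and under multiplication by numbers $t\ge 0$, has nonempty interior, and satisfies $K\cap(-K)=\{0\}$. A real $d\times d$ matrix $A$ leaves $K$ invariant if $AK\subset K$. A multiplicative semigroup $\mathcal S$ of real $d\times d$ matrices is irreducible if its matrices have no common real invariant linear subspace other than $\{0\}$ and $\mathbb R^d$. The expansion index of a real matrix $A$ is the sum of the geometric multiplicities (over $\mathbb C$) of the complex eigenvalues of $A$ of maximal modulus; the expansion index of $\mathcal S$ is the minimum of the expansion indices of its elements. Let $\mathcal S$ be an irreducible multiplicative semigroup of real $d\times d$ matrices such that every $A\in\mathcal S$ leaves some cone $K_A$ invariant (the cones may differ for different matrices). Then, unless the expansion index of $\mathcal S$ is at least $3$, there is a single cone $K$ that is left invariant by all matrices of $\mathcal S$. -/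

import Mathlib

/-- A closed convex cone `K ⊆ ℝ^d` (a closed set containing `0` and stable under addition and under
multiplication by nonnegative scalars, i.e. a `ProperCone` in Mathlib's sense) is a *solid pointed*
cone if it has nonempty interior and `K ∩ (-K) = {0}`. -/
def IsSolidPointedCone {d : ℕ} (K : ProperCone ℝ (Fin d → ℝ)) : Prop :=
  (interior (K : Set (Fin d → ℝ))).Nonempty ∧
    (K : Set (Fin d → ℝ)) ∩ {x | -x ∈ K} = {0}

/-- The matrix `A` leaves the cone `K` invariant: `A K ⊆ K`. -/
def LeavesInvariant {d : ℕ} (A : Matrix (Fin d) (Fin d) ℝ)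
    (K : ProperCone ℝ (Fin d → ℝ)) : Prop :=
  ∀ x ∈ K, A.mulVec x ∈ K

/-- A multiplicative semigroup of real `d × d` matrices is irreducible if its matrices share no
real invariant subspace other than `0` and `ℝ^d`. -/
def IsIrreducibleSemigroup {d : ℕ} (S : Subsemigroup (Matrix (Fin d) (Fin d) ℝ)) : Prop :=
  ∀ W : Submodule ℝ (Fin d → ℝ),
    (∀ A ∈ S, ∀ x ∈ W, A.mulVec x ∈ W) → W = ⊥ ∨ W = ⊤

/-- The operator on `ℂ^d` given by a real `d × d` matrix. -/
noncomputable def complexOperator {d : ℕ} (A : Matrix (Fin d) (Fin d) ℝ) :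
    Module.End ℂ (Fin d → ℂ) :=
  Matrix.toLin' (A.map (fun a : ℝ => (a : ℂ)))

/-- The leading eigenvalues of a real matrix: its complex eigenvalues of maximal modulus. -/
def leadingEigenvalues {d : ℕ} (A : Matrix (Fin d) (Fin d) ℝ) : Set ℂ :=
  {μ | (complexOperator A).HasEigenvalue μ ∧
    ∀ ν : ℂ, (complexOperator A).HasEigenvalue ν → ‖ν‖ ≤ ‖μ‖}

theorem leadingEigenvalues_finite {d : ℕ} (A : Matrix (Fin d) (Fin d) ℝ) :
    (leadingEigenvalues A).Finite :=
  (Module.End.finite_hasEigenvalue (complexOperator A)).subset fun _ h => h.1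

/-- The expansion index of a real matrix: the sum of the geometric multiplicities of its leading
eigenvalues. -/
noncomputable def expansionIndex {d : ℕ} (A : Matrix (Fin d) (Fin d) ℝ) : ℕ :=
  ∑ μ ∈ (leadingEigenvalues_finite A).toFinset,
    Module.finrank ℂ ((complexOperator A).eigenspace μ)

/-- The expansion index of a matrix semigroup: the minimal expansion index of its elements. -/
noncomputable def semigroupExpansionIndex {d : ℕ}
    (S : Subsemigroup (Matrix (Fin d) (Fin d) ℝ)) : ℕ :=
  sInf {n : ℕ | ∃ A ∈ S, expansionIndex A = n}

/-! Let `T` be the closed set of limits of nonnegative multiples of elements of `S ∪ {1}`; it is a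
semigroup. A matrix with an invariant solid pointed cone has its spectral radius as an eigenvalue
(`hasDominantRoot_of_leavesInvariant`), and this property passes to limits
(`isClosed_setOf_hasDominantRoot`), so all of `T` has it.

A limit of normalized powers of `A` kills the non-leading generalized eigenspaces and maps the
leading ones into eigenvectors; its rank is therefore at most the expansion index
(`exists_mem_closure_rank_le_expansionIndex`). So `T` contains a nonzero matrix of rank at most 2.
Take a nonzero `P ∈ T` of minimal rank `k ≤ 2` and factor `P = E * F` through `ℝ^k`. The
compressions `F * B * E` with `B ∈ T` have as closure a closed homogeneous semigroup of `k × k`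
matrices, still with dominant roots, and by minimality each nonzero one is invertible.

For `k = 2` such a semigroup is nearly trivial (`exists_forall_eq_smul_of_fin_two`): compactness
bounds its elements of determinant `±1`, those of determinant 1 are then the identity, and those of
determinant `-1` coincide with a single involution fixing a nonzero vector `v`. Hence `w ⬝ᵥ C *ᵥ v ≥
0` for all compressions `C` and a suitable `w ≠ 0`; the case `k = 1` is immediate. With `x = E *ᵥ v`
and `g = w ᵥ* F`, the orbit of `x` lies in the half-space `g ≥ 0`, and irreducibility makes the
closed convex cone spanned by this orbit solid and pointed
(`exists_invariant_cone_of_orbit_nonneg`). -/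

/-! ### Growth of powers on generalized eigenspaces. -/

section Asymptotics

open Filter Topology Asymptotics

theorem Module.End.hasEigenvalue_of_mem_maxGenEigenspace {K V : Type*} [Field K] [AddCommGroup V]
    [Module K V] {f : Module.End K V} {μ : K} {x : V} (hx : x ∈ f.maxGenEigenspace μ)
    (hx0 : x ≠ 0) : f.HasEigenvalue μ := by
  obtain ⟨k, hk⟩ := (Module.End.mem_maxGenEigenspace f μ x).1 hx
  have : f.HasGenEigenvalue μ k := by
    rw [Module.End.hasGenEigenvalue_iff]
    intro hbot
    have hmem : x ∈ f.genEigenspace μ k := Module.End.mem_genEigenspace_nat.2 (by simpa using hk)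
    rw [hbot] at hmem
    exact hx0 (by simpa using hmem)
  exact Module.End.hasEigenvalue_of_hasGenEigenvalue this

variable {V : Type*} [AddCommGroup V] [Module ℂ V]

theorem pow_apply_eq_sum_choose (f : Module.End ℂ V) (μ : ℂ) (x : V) (j n : ℕ) (hn : j ≤ n)
    (hx : ((f - algebraMap ℂ (Module.End ℂ V) μ) ^ (j + 1)) x = 0) :
    (f ^ n) x = ∑ i ∈ Finset.range (j + 1),
      ((n.choose i : ℂ) * μ ^ (n - i)) • ((f - algebraMap ℂ (Module.End ℂ V) μ) ^ i) x := by
  set N := f - algebraMap ℂ (Module.End ℂ V) μ with hN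
  have hf : f = N + algebraMap ℂ (Module.End ℂ V) μ := by simp [hN]
  have hcomm : Commute N (algebraMap ℂ (Module.End ℂ V) μ) := (Algebra.commutes μ N).symm
  have hzero : ∀ i, j + 1 ≤ i → (N ^ i) x = 0 := by
    intro i hi
    obtain ⟨k, rfl⟩ := Nat.exists_eq_add_of_le' hi
    rw [pow_add, Module.End.mul_apply, hx, map_zero]
  rw [hf, hcomm.add_pow, LinearMap.sum_apply]
  rw [← Finset.sum_subset (Finset.range_subset_range.2 (Nat.succ_le_succ hn))]
  · refine Finset.sum_congr rfl fun i _ => ?_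
    rw [← map_pow, mul_assoc, Module.End.mul_apply, Module.End.mul_apply, Module.End.natCast_apply,
      Module.algebraMap_end_apply, map_smul, ← Nat.cast_smul_eq_nsmul ℂ, map_smul, smul_smul,
      mul_comm]
  · intro i _ hi
    rw [Finset.mem_range, not_lt] at hi
    rw [← map_pow, mul_assoc, Module.End.mul_apply, Module.End.mul_apply, Module.End.natCast_apply,
      Module.algebraMap_end_apply, map_smul, ← Nat.cast_smul_eq_nsmul ℂ, map_smul, hzero i hi]
    simp

theorem tendsto_choose_div_choose {i j : ℕ} (h : i < j) :
    Tendsto (fun n : ℕ => ((n.choose i : ℝ) / (n.choose j : ℝ))) atTop (𝓝 0) := by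
  have h1 : (fun n : ℕ => (n.choose i : ℝ)) =O[atTop] fun n : ℕ => (n : ℝ) ^ i :=
    (isTheta_choose i).1
  have h2 : (fun n : ℕ => (n : ℝ) ^ j) =O[atTop] fun n : ℕ => (n.choose j : ℝ) :=
    (isTheta_choose j).2
  have h3 : (fun n : ℕ => (n : ℝ) ^ i) =o[atTop] fun n : ℕ => (n : ℝ) ^ j :=
    (isLittleO_pow_pow_atTop_of_lt h).comp_tendsto tendsto_natCast_atTop_atTop
  exact ((h1.trans_isLittleO h3).trans_isBigO h2).tendsto_div_nhds_zero

variable {W : Type*} [NormedAddCommGroup W] [NormedSpace ℂ W]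

/-- On a vector killed by `(f - μ) ^ (j + 1)`, the powers of `f` grow like `choose n j * μ ^ n`. -/
theorem tendsto_inv_choose_smul_pow_apply (f : Module.End ℂ W) {μ : ℂ} (hμ : μ ≠ 0) (x : W)
    (j : ℕ) (hx : ((f - algebraMap ℂ (Module.End ℂ W) μ) ^ (j + 1)) x = 0) :
    Tendsto (fun n : ℕ => ((n.choose j : ℂ) * μ ^ n)⁻¹ • (f ^ n) x) atTop
      (𝓝 ((μ ^ j)⁻¹ • ((f - algebraMap ℂ (Module.End ℂ W) μ) ^ j) x)) := by
  set N := f - algebraMap ℂ (Module.End ℂ W) μ with hN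
  have key : Tendsto (fun n : ℕ => ∑ i ∈ Finset.range (j + 1),
      ((((n.choose i : ℝ) / (n.choose j : ℝ) : ℝ) : ℂ) * (μ ^ i)⁻¹) • (N ^ i) x) atTop
      (𝓝 (∑ i ∈ Finset.range (j + 1), (if i = j then (μ ^ j)⁻¹ else 0) • (N ^ i) x)) := by
    refine tendsto_finsetSum _ fun i hi => Tendsto.smul_const ?_ _
    rcases (Nat.lt_succ_iff.1 (Finset.mem_range.1 hi)).lt_or_eq with h | rfl
    · rw [if_neg h.ne]
      have := (Complex.continuous_ofReal.tendsto 0).comp (tendsto_choose_div_choose h)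
      simpa using this.mul_const ((μ ^ i)⁻¹)
    · rw [if_pos rfl]
      refine tendsto_const_nhds.congr' ?_
      filter_upwards [eventually_ge_atTop i] with n hn
      have : (n.choose i : ℝ) ≠ 0 := by exact_mod_cast (Nat.choose_pos hn).ne'
      rw [div_self this]; simp
  have hlim : (∑ i ∈ Finset.range (j + 1), (if i = j then (μ ^ j)⁻¹ else 0) • (N ^ i) x)
      = (μ ^ j)⁻¹ • (N ^ j) x := by
    rw [Finset.sum_eq_single j]
    · simp
    · intro b _ hb; simp [hb]
    · simp
  rw [hlim] at key
  refine key.congr' ?_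
  filter_upwards [eventually_ge_atTop j] with n hn
  rw [pow_apply_eq_sum_choose f μ x j n hn hx, Finset.smul_sum]
  refine Finset.sum_congr rfl fun i hi => ?_
  have hi' : i ≤ n := (Nat.lt_succ_iff.1 (Finset.mem_range.1 hi)).trans hn
  rw [smul_smul]
  congr 1
  have h1 : (n.choose j : ℂ) ≠ 0 := by exact_mod_cast (Nat.choose_pos hn).ne'
  have h2 : μ ^ n = μ ^ (n - i) * μ ^ i := by rw [← pow_add, Nat.sub_add_cancel hi']
  rw [h2]
  push_cast
  have h3 : μ ^ (n - i) ≠ 0 := pow_ne_zero _ hμ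
  have h4 : μ ^ i ≠ 0 := pow_ne_zero _ hμ
  field_simp

theorem exists_pow_apply_eq_zero_of_mem_maxGenEigenspace {f : Module.End ℂ V} {μ : ℂ} {x : V}
    (hx : x ∈ f.maxGenEigenspace μ) (hx0 : x ≠ 0) :
    ∃ j, ((f - algebraMap ℂ (Module.End ℂ V) μ) ^ (j + 1)) x = 0 ∧
      ((f - algebraMap ℂ (Module.End ℂ V) μ) ^ j) x ≠ 0 := by
  classical
  have hex : ∃ k, ((f - algebraMap ℂ (Module.End ℂ V) μ) ^ k) x = 0 := by
    obtain ⟨k, hk⟩ := (Module.End.mem_maxGenEigenspace f μ x).1 hx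
    exact ⟨k, by simpa [Algebra.algebraMap_eq_smul_one] using hk⟩
  have hpos : Nat.find hex ≠ 0 := by
    intro h0
    have := Nat.find_spec hex
    rw [h0] at this
    exact hx0 (by simpa using this)
  obtain ⟨j, hj⟩ := Nat.exists_eq_succ_of_ne_zero hpos
  refine ⟨j, by simpa [hj] using Nat.find_spec hex, Nat.find_min hex (by omega)⟩

/-- With `j` maximal such that `N ^ j x ≠ 0`, where `N = f - μ`, the normalized vectors `f ^ n x`
converge to a nonzero multiple of `N ^ j x`, and `N` kills that limit. Thus orbits become
asymptotically eigenvectors. -/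
theorem sub_smul_pow_apply_isLittleO [FiniteDimensional ℂ W] (f : Module.End ℂ W) {μ : ℂ}
    (hμ : μ ≠ 0) {x : W} (hx : x ∈ f.maxGenEigenspace μ) :
    (fun n : ℕ => (f - algebraMap ℂ (Module.End ℂ W) μ) ((f ^ n) x)) =o[atTop]
      fun n : ℕ => (f ^ n) x := by
  rcases eq_or_ne x 0 with rfl | hx0
  · simp
  obtain ⟨j, hj, hj'⟩ := exists_pow_apply_eq_zero_of_mem_maxGenEigenspace hx hx0
  have h1 := tendsto_inv_choose_smul_pow_apply f hμ x j hj
  set N := f - algebraMap ℂ (Module.End ℂ W) μ with hN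
  have hcont : Continuous N := N.continuous_of_finiteDimensional
  have h2 := (hcont.tendsto _).comp h1
  rw [map_smul, ← Module.End.mul_apply, ← pow_succ', hj, smul_zero] at h2
  have hy : (μ ^ j)⁻¹ • (N ^ j) x ≠ 0 := smul_ne_zero (inv_ne_zero (pow_ne_zero _ hμ)) hj'
  have h3 : (fun n : ℕ => N (((n.choose j : ℂ) * μ ^ n)⁻¹ • (f ^ n) x)) =o[atTop]
      fun n : ℕ => ((n.choose j : ℂ) * μ ^ n)⁻¹ • (f ^ n) x := by
    have ha : (fun n : ℕ => N (((n.choose j : ℂ) * μ ^ n)⁻¹ • (f ^ n) x)) =o[atTop]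
        fun _ : ℕ => (1 : ℝ) := (isLittleO_one_iff ℝ).2 h2
    exact ha.trans_isBigO ((isBigO_const_left_iff_pos_le_norm one_ne_zero).2
      ⟨‖(μ ^ j)⁻¹ • (N ^ j) x‖ / 2, by positivity, by
        filter_upwards [h1.norm.eventually (lt_mem_nhds (half_lt_self (norm_pos_iff.2 hy)))]
          with n hn
        exact hn.le⟩)
  rw [isLittleO_iff] at h3 ⊢
  intro c hc
  filter_upwards [h3 hc, eventually_ge_atTop j] with n hn hnj
  rw [map_smul, norm_smul, norm_smul, mul_left_comm] at hn
  refine le_of_mul_le_mul_left hn (norm_pos_iff.2 (inv_ne_zero (mul_ne_zero ?_ (pow_ne_zero _ hμ))))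
  exact_mod_cast (Nat.choose_pos hnj).ne'

theorem pow_apply_isLittleO_of_mem_maxGenEigenspace (f : Module.End ℂ W) {μ : ℂ} {t : ℝ}
    (ht : ‖μ‖ < t) {x : W} (hx : x ∈ f.maxGenEigenspace μ) :
    (fun n : ℕ => (f ^ n) x) =o[atTop] fun n : ℕ => t ^ n := by
  rcases eq_or_ne x 0 with rfl | hx0
  · simp
  obtain ⟨j, hj, -⟩ := exists_pow_apply_eq_zero_of_mem_maxGenEigenspace hx hx0
  have ht0 : 0 < t := (norm_nonneg μ).trans_lt ht
  rcases eq_or_ne μ 0 with rfl | hμ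
  · have : (fun n : ℕ => (f ^ n) x) =ᶠ[atTop] fun _ => 0 := by
      filter_upwards [eventually_ge_atTop (j + 1)] with n hn
      obtain ⟨k, rfl⟩ := Nat.exists_eq_add_of_le' hn
      simp only [map_zero, sub_zero] at hj
      rw [pow_add, Module.End.mul_apply, hj, map_zero]
    exact this.trans_isLittleO (isLittleO_zero _ _)
  have h1 := (tendsto_inv_choose_smul_pow_apply f hμ x j hj).isBigO_one ℝ
  have h2 : (fun n : ℕ => (f ^ n) x) =O[atTop] fun n : ℕ => (n.choose j : ℝ) * ‖μ‖ ^ n := by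
    rw [isBigO_iff] at h1 ⊢
    obtain ⟨c, hc⟩ := h1
    refine ⟨c, ?_⟩
    filter_upwards [hc, eventually_ge_atTop j] with n hn hnj
    have hpos : (0 : ℝ) < n.choose j * ‖μ‖ ^ n :=
      mul_pos (by exact_mod_cast Nat.choose_pos hnj) (pow_pos (norm_pos_iff.2 hμ) _)
    rw [norm_smul, norm_inv, norm_mul, norm_pow, Complex.norm_natCast, norm_one, mul_one,
      inv_mul_le_iff₀ hpos] at hn
    rw [Real.norm_of_nonneg hpos.le, mul_comm]
    exact hn
  have h3 : (fun n : ℕ => (n.choose j : ℝ) * ‖μ‖ ^ n) =O[atTop]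
      fun n : ℕ => (n : ℝ) ^ j * ‖μ‖ ^ n := (isTheta_choose j).1.mul (isBigO_refl _ _)
  have h4 : (fun n : ℕ => (n : ℝ) ^ j * ‖μ‖ ^ n) =o[atTop] fun n : ℕ => t ^ n :=
    isLittleO_pow_const_mul_const_pow_const_pow_of_norm_lt j (by simpa using ht)
  exact (h2.trans h3).trans_isLittleO h4

theorem pow_apply_isLittleO_of_forall_eigenvalue_lt [FiniteDimensional ℂ W] (f : Module.End ℂ W)
    {t : ℝ} (ht : ∀ μ, f.HasEigenvalue μ → ‖μ‖ < t) (x : W) :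
    (fun n : ℕ => (f ^ n) x) =o[atTop] fun n : ℕ => t ^ n := by
  have hx : x ∈ ⨆ μ, f.maxGenEigenspace μ := by
    rw [Module.End.iSup_maxGenEigenspace_eq_top]; trivial
  induction hx using Submodule.iSup_induction' with
  | mem μ x hx =>
    rcases eq_or_ne x 0 with rfl | hx0
    · simp
    refine pow_apply_isLittleO_of_mem_maxGenEigenspace f 
      (ht μ (Module.End.hasEigenvalue_of_mem_maxGenEigenspace hx hx0)) hx
  | zero => simp
  | add x y _ _ hx hy => simpa using hx.add hy

end Asymptotics

/-! ### Perron–Frobenius for invariant cones, and closedness of the dominant root property. -/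

section Dominant

open Filter Topology Asymptotics Matrix Polynomial

variable {n : Type*} [Fintype n] [DecidableEq n]

/-- The spectral radius of the real matrix `A` is an eigenvalue of `A`. -/
def HasDominantRoot (A : Matrix n n ℝ) : Prop :=
  ∃ r : ℝ, 0 ≤ r ∧ A.charpoly.eval r = 0 ∧
    ∀ z : ℂ, (A.map (algebraMap ℝ ℂ)).charpoly.eval z = 0 → ‖z‖ ≤ r

theorem Matrix.eval_charpoly_eq_det {R : Type*} [CommRing R] (A : Matrix n n R) (t : R) :
    A.charpoly.eval t = (t • (1 : Matrix n n R) - A).det := by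
  rw [Matrix.eval_charpoly, Matrix.scalar_apply, Matrix.smul_one_eq_diagonal]

theorem Matrix.eval_charpoly_map_ofReal (A : Matrix n n ℝ) (t : ℝ) :
    (A.map (algebraMap ℝ ℂ)).charpoly.eval (t : ℂ) = (A.charpoly.eval t : ℝ) := by
  rw [Matrix.charpoly_map, ← Complex.coe_algebraMap, Polynomial.eval_map_algebraMap,
    Polynomial.aeval_algebraMap_apply]
  simp

theorem Matrix.exists_mulVec_eq_smul_of_eval_charpoly_eq_zero {K : Type*} [Field K]
    (A : Matrix n n K) {t : K} (h : A.charpoly.eval t = 0) : ∃ v ≠ 0, A *ᵥ v = t • v := by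
  rw [Matrix.eval_charpoly_eq_det] at h
  obtain ⟨v, hv, hAv⟩ := Matrix.exists_mulVec_eq_zero_iff.2 h
  refine ⟨v, hv, ?_⟩
  rw [Matrix.sub_mulVec, Matrix.smul_mulVec, Matrix.one_mulVec, sub_eq_zero] at hAv
  exact hAv.symm

theorem Matrix.eval_charpoly_eq_zero_of_mulVec_eq_smul {K : Type*} [Field K]
    (A : Matrix n n K) {t : K} {v : n → K} (hv : v ≠ 0) (h : A *ᵥ v = t • v) :
    A.charpoly.eval t = 0 := by
  rw [Matrix.eval_charpoly_eq_det]
  refine Matrix.exists_mulVec_eq_zero_iff.1 ⟨v, hv, ?_⟩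
  rw [Matrix.sub_mulVec, Matrix.smul_mulVec, Matrix.one_mulVec, h, sub_self]

theorem Matrix.hasEigenvalue_toLin'_iff {K : Type*} [Field K] (A : Matrix n n K) (t : K) :
    Module.End.HasEigenvalue (Matrix.toLin' A) t ↔ A.charpoly.eval t = 0 := by
  constructor
  · intro h
    obtain ⟨v, hv⟩ := h.exists_hasEigenvector
    exact A.eval_charpoly_eq_zero_of_mulVec_eq_smul hv.2 (by simpa using hv.apply_eq_smul)
  · intro h
    obtain ⟨v, hv, hAv⟩ := A.exists_mulVec_eq_smul_of_eval_charpoly_eq_zero h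
    exact Module.End.hasEigenvalue_of_hasEigenvector (x := v)
      (Module.End.hasEigenvector_iff.2 ⟨Module.End.mem_eigenspace_iff.2 (by simpa using hAv), hv⟩)

theorem Matrix.exists_root_norm_max [Nonempty n] (M : Matrix n n ℂ) :
    ∃ z : ℂ, M.charpoly.eval z = 0 ∧ ∀ w : ℂ, M.charpoly.eval w = 0 → ‖w‖ ≤ ‖z‖ := by
  have hne : M.charpoly ≠ 0 := M.charpoly_monic.ne_zero
  have hfin : {z : ℂ | M.charpoly.eval z = 0}.Finite := by
    refine (M.charpoly.roots.toFinset.finite_toSet).subset fun z hz => ?_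
    simpa [hne] using hz
  have hnon : {z : ℂ | M.charpoly.eval z = 0}.Nonempty := by
    obtain ⟨z, hz⟩ := Complex.exists_root (f := M.charpoly) (by
      rw [Matrix.charpoly_degree_eq_dim]; exact_mod_cast Fintype.card_pos)
    exact ⟨z, hz⟩
  exact Set.exists_max_image _ (fun z : ℂ => ‖z‖) hfin hnon

theorem Matrix.map_ofReal_mulVec_pow (A : Matrix n n ℝ) (x : n → ℝ) (k : ℕ) :
    (A.map (algebraMap ℝ ℂ)) ^ k *ᵥ (fun i => (x i : ℂ)) = fun i => (((A ^ k) *ᵥ x) i : ℂ) := by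
  rw [← Matrix.map_pow]
  ext i
  simp [Matrix.mulVec, dotProduct]

theorem Matrix.pow_mulVec_isLittleO (A : Matrix n n ℝ) {t : ℝ}
    (ht : ∀ z : ℂ, (A.map (algebraMap ℝ ℂ)).charpoly.eval z = 0 → ‖z‖ < t) (x : n → ℝ) :
    (fun k : ℕ => (A ^ k) *ᵥ x) =o[atTop] fun k : ℕ => t ^ k := by
  have h := pow_apply_isLittleO_of_forall_eigenvalue_lt
    (Matrix.toLin' (A.map (algebraMap ℝ ℂ))) (t := t)
    (fun μ hμ => ht μ ((Matrix.hasEigenvalue_toLin'_iff _ _).1 hμ)) (fun i => (x i : ℂ))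
  refine (IsBigO.of_bound 1 (Eventually.of_forall fun k => ?_)).trans_isLittleO h
  rw [← Matrix.toLin'_pow, Matrix.toLin'_apply, Matrix.map_ofReal_mulVec_pow, one_mul]
  refine (pi_norm_le_iff_of_nonneg (norm_nonneg _)).2 fun i => ?_
  have := norm_le_pi_norm (fun i => (((A ^ k) *ᵥ x) i : ℂ)) i
  simpa using this

/-- Pointedness puts `y` or `-y` outside the closed cone, and that vector can be separated from it.
-/
theorem exists_dual_vector_ne_zero {d : ℕ} {K : ProperCone ℝ (Fin d → ℝ)}
    (hK : (K : Set (Fin d → ℝ)) ∩ {x | -x ∈ K} = {0}) {y : Fin d → ℝ} (hy : y ≠ 0) :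
    ∃ w : Fin d → ℝ, (∀ x ∈ K, 0 ≤ w ⬝ᵥ x) ∧ w ⬝ᵥ y ≠ 0 := by
  have sep : ∀ z : Fin d → ℝ, z ∉ K → ∃ w : Fin d → ℝ, (∀ x ∈ K, 0 ≤ w ⬝ᵥ x) ∧ w ⬝ᵥ z ≠ 0 := by
    intro z hz
    obtain ⟨f, hf, hfz⟩ := K.hyperplane_separation_point hz
    have hrep : ∀ x : Fin d → ℝ, (fun i => f (Pi.single i 1)) ⬝ᵥ x = f x := by
      intro x
      conv_rhs => rw [← Finset.univ_sum_single x]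
      rw [map_sum]
      refine Finset.sum_congr rfl fun i _ => ?_
      have : Pi.single i (x i) = x i • (Pi.single i (1 : ℝ) : Fin d → ℝ) := by
        rw [← Pi.single_smul, smul_eq_mul, mul_one]
      rw [this, map_smul, smul_eq_mul, mul_comm]
    refine ⟨fun i => f (Pi.single i 1), fun x hx => ?_, ?_⟩
    · rw [hrep]; exact hf x hx
    · rw [hrep]; exact hfz.ne
  by_cases h : y ∈ K
  · have hn : -y ∉ K := fun hn => hy (by
      have : y ∈ (K : Set (Fin d → ℝ)) ∩ {x | -x ∈ K} := ⟨h, hn⟩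
      rwa [hK] at this)
    obtain ⟨w, hw, hwy⟩ := sep _ hn
    exact ⟨w, hw, by simpa using hwy⟩
  · exact sep y h

theorem exists_pos_add_smul_mem_sub_smul_mem {d : ℕ} {K : ProperCone ℝ (Fin d → ℝ)}
    {e : Fin d → ℝ} (he : e ∈ interior (K : Set (Fin d → ℝ))) (x : Fin d → ℝ) :
    ∃ s : ℝ, 0 < s ∧ e + s • x ∈ K ∧ e - s • x ∈ K := by
  have hnhds := mem_interior_iff_mem_nhds.1 he
  have h1 : Tendsto (fun s : ℝ => e + s • x) (𝓝[>] 0) (𝓝 e) := by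
    have : ContinuousAt (fun s : ℝ => e + s • x) 0 := by fun_prop
    simpa using this.tendsto.mono_left nhdsWithin_le_nhds
  have h2 : Tendsto (fun s : ℝ => e - s • x) (𝓝[>] 0) (𝓝 e) := by
    have : ContinuousAt (fun s : ℝ => e - s • x) 0 := by fun_prop
    simpa using this.tendsto.mono_left nhdsWithin_le_nhds
  obtain ⟨s, hs⟩ := ((h1.eventually_mem hnhds).and
    ((h2.eventually_mem hnhds).and self_mem_nhdsWithin)).exists
  exact ⟨s, hs.2.2, hs.1, hs.2.1⟩

theorem LeavesInvariant.pow_mem {d : ℕ} {A : Matrix (Fin d) (Fin d) ℝ}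
    {K : ProperCone ℝ (Fin d → ℝ)} (hA : LeavesInvariant A K) (k : ℕ) {x : Fin d → ℝ}
    (hx : x ∈ K) : (A ^ k) *ᵥ x ∈ K := by
  induction k with
  | zero => simpa
  | succ k ih => rw [pow_succ', ← Matrix.mulVec_mulVec]; exact hA _ ih

/-- Along an invariant cone with interior vector `e`, a suitable positive functional of `A ^ k e`
grows at least like the modulus of any given eigenvalue. -/
theorem exists_growth_of_leavesInvariant {d : ℕ} {A : Matrix (Fin d) (Fin d) ℝ}
    {K : ProperCone ℝ (Fin d → ℝ)} (hK : (K : Set (Fin d → ℝ)) ∩ {x | -x ∈ K} = {0})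
    (hA : LeavesInvariant A K) {e : Fin d → ℝ} (he : e ∈ interior (K : Set (Fin d → ℝ)))
    {z : ℂ} (hz : (A.map (algebraMap ℝ ℂ)).charpoly.eval z = 0) :
    ∃ w : Fin d → ℝ, ∃ c : ℝ, 0 < c ∧ ∀ k : ℕ, c * ‖z‖ ^ k ≤ w ⬝ᵥ ((A ^ k) *ᵥ e) := by
  obtain ⟨u, hu, hAu⟩ := Matrix.exists_mulVec_eq_smul_of_eval_charpoly_eq_zero _ hz
  set a : Fin d → ℝ := fun i => (u i).re with ha
  set b : Fin d → ℝ := fun i => (u i).im with hb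
  have huab : u = (fun i => (a i : ℂ)) + Complex.I • (fun i => (b i : ℂ)) := by
    ext i
    simp [ha, hb, mul_comm Complex.I, Complex.re_add_im]
  obtain ⟨w, hw, hwu⟩ : ∃ w : Fin d → ℝ, (∀ x ∈ K, 0 ≤ w ⬝ᵥ x) ∧
      (w ⬝ᵥ a ≠ 0 ∨ w ⬝ᵥ b ≠ 0) := by
    by_cases h : a = 0
    · have hb0 : b ≠ 0 := by
        rintro hb0
        apply hu
        rw [huab, h, hb0]
        ext; simp
      obtain ⟨w, hw, h⟩ := exists_dual_vector_ne_zero hK hb0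
      exact ⟨w, hw, Or.inr h⟩
    · obtain ⟨w, hw, h⟩ := exists_dual_vector_ne_zero hK h
      exact ⟨w, hw, Or.inl h⟩
  -- The interior vector `e` dominates `± s • x` for some `s > 0`, and invariance carries this to
  -- every power, so `C = s⁻¹` works uniformly in `k`.
  have bound : ∀ x : Fin d → ℝ, ∃ C : ℝ, 0 < C ∧ ∀ k : ℕ,
      |w ⬝ᵥ ((A ^ k) *ᵥ x)| ≤ C * (w ⬝ᵥ ((A ^ k) *ᵥ e)) := by
    intro x
    obtain ⟨s, hs, h1, h2⟩ := exists_pos_add_smul_mem_sub_smul_mem he x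
    refine ⟨s⁻¹, inv_pos.2 hs, fun k => ?_⟩
    have h1' := hw _ (hA.pow_mem k h1)
    have h2' := hw _ (hA.pow_mem k h2)
    rw [Matrix.mulVec_add, dotProduct_add, Matrix.mulVec_smul, dotProduct_smul, smul_eq_mul] at h1'
    rw [Matrix.mulVec_sub, dotProduct_sub, Matrix.mulVec_smul, dotProduct_smul, smul_eq_mul] at h2'
    have habs : s * |w ⬝ᵥ ((A ^ k) *ᵥ x)| = |s * (w ⬝ᵥ ((A ^ k) *ᵥ x))| := by
      rw [abs_mul, abs_of_pos hs]
    rw [le_inv_mul_iff₀ hs, habs, abs_le]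
    constructor <;> linarith
  obtain ⟨C₁, hC₁, h1⟩ := bound a
  obtain ⟨C₂, hC₂, h2⟩ := bound b
  set wc : Fin d → ℂ := fun i => (w i : ℂ) with hwc
  have hdot : ∀ x : Fin d → ℝ, wc ⬝ᵥ (fun i => (x i : ℂ)) = ((w ⬝ᵥ x : ℝ) : ℂ) := by
    intro x; simp [dotProduct, hwc]
  have hpow : ∀ k : ℕ, (A.map (algebraMap ℝ ℂ)) ^ k *ᵥ u = z ^ k • u := by
    intro k
    induction k with
    | zero => simp
    | succ k ih =>
      rw [pow_succ', ← Matrix.mulVec_mulVec, ih, Matrix.mulVec_smul, hAu, smul_smul, pow_succ]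
  have hF0 : wc ⬝ᵥ u ≠ 0 := by
    rw [huab, dotProduct_add, dotProduct_smul, hdot, hdot, smul_eq_mul]
    intro h
    have hre := congrArg Complex.re h
    have him := congrArg Complex.im h
    simp at hre him
    rcases hwu with h | h
    · exact h hre
    · exact h him
  refine ⟨w, ‖wc ⬝ᵥ u‖ / (C₁ + C₂), div_pos (norm_pos_iff.2 hF0) (add_pos hC₁ hC₂), fun k => ?_⟩
  have h3 : ‖z‖ ^ k * ‖wc ⬝ᵥ u‖ ≤ |w ⬝ᵥ ((A ^ k) *ᵥ a)| + |w ⬝ᵥ ((A ^ k) *ᵥ b)| := by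
    have : z ^ k * (wc ⬝ᵥ u) = ((w ⬝ᵥ ((A ^ k) *ᵥ a) : ℝ) : ℂ) +
        Complex.I * ((w ⬝ᵥ ((A ^ k) *ᵥ b) : ℝ) : ℂ) := by
      rw [← smul_eq_mul, ← dotProduct_smul, ← hpow k]
      conv_lhs => rw [huab]
      rw [Matrix.mulVec_add, Matrix.mulVec_smul, Matrix.map_ofReal_mulVec_pow,
        Matrix.map_ofReal_mulVec_pow, dotProduct_add, dotProduct_smul, hdot, hdot, smul_eq_mul]
    rw [← norm_pow, ← norm_mul, this]
    refine (norm_add_le _ _).trans ?_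
    simp
  rw [div_mul_eq_mul_div, div_le_iff₀ (add_pos hC₁ hC₂)]
  nlinarith [h1 k, h2 k]

/-- A matrix with a solid pointed invariant cone has its spectral radius as an eigenvalue. -/
theorem hasDominantRoot_of_leavesInvariant {d : ℕ} [NeZero d] {A : Matrix (Fin d) (Fin d) ℝ}
    {K : ProperCone ℝ (Fin d → ℝ)} (hK : IsSolidPointedCone K) (hA : LeavesInvariant A K) :
    HasDominantRoot A := by
  obtain ⟨z, hz, hmax⟩ := Matrix.exists_root_norm_max (A.map (algebraMap ℝ ℂ))
  refine ⟨‖z‖, norm_nonneg _, ?_, hmax⟩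
  by_contra hne
  obtain ⟨e, he⟩ := hK.1
  obtain ⟨w, c, hc, hgrow⟩ := exists_growth_of_leavesInvariant hK.2 hA he hz
  set ρ := ‖z‖ with hρ
  have hρ0 : 0 ≤ ρ := norm_nonneg z
  have hdet : ∀ t : ℝ, ρ < t → (t • (1 : Matrix (Fin d) (Fin d) ℝ) - A).det ≠ 0 := by
    intro t ht h0
    rw [← Matrix.eval_charpoly_eq_det] at h0
    have := hmax t (by rw [Matrix.eval_charpoly_map_ofReal, h0]; simp)
    rw [Complex.norm_real, Real.norm_of_nonneg (hρ0.trans ht.le)] at this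
    exact absurd this (not_le.2 ht)
  -- Here `y` is the resolvent `∑ A ^ k e / t ^ (k + 1)`, and termwise growth gives `w ⬝ᵥ y ≥ ∑ c ρ
  -- ^ k / t ^ (k + 1) = c / (t - ρ)`. The partial sums are handled by telescoping.
  have hresolvent : ∀ (t : ℝ), ρ < t → ∀ y : Fin d → ℝ, t • y - A *ᵥ y = e →
      c ≤ (t - ρ) * (w ⬝ᵥ y) := by
    intro t ht y hy
    have ht0 : 0 < t := hρ0.trans_lt ht
    have hstep : ∀ k : ℕ, w ⬝ᵥ ((A ^ k) *ᵥ e) =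
        t * (w ⬝ᵥ ((A ^ k) *ᵥ y)) - w ⬝ᵥ ((A ^ (k + 1)) *ᵥ y) := by
      intro k
      rw [← hy, Matrix.mulVec_sub, Matrix.mulVec_smul, Matrix.mulVec_mulVec, ← pow_succ,
        dotProduct_sub, dotProduct_smul, smul_eq_mul]
    have hpartial : ∀ k : ℕ, c * (1 - (ρ / t) ^ k) ≤
        (t - ρ) * (w ⬝ᵥ y - (w ⬝ᵥ ((A ^ k) *ᵥ y)) / t ^ k) := by
      intro k
      induction k with
      | zero => simp
      | succ k ih =>
        have h1 := hgrow k
        rw [hstep k] at h1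
        have htk : 0 < t ^ k := pow_pos ht0 k
        have h2 : c * ((ρ / t) ^ k * (1 - ρ / t)) ≤ (t - ρ) * ((w ⬝ᵥ ((A ^ k) *ᵥ y)) / t ^ k -
            (w ⬝ᵥ ((A ^ (k + 1)) *ᵥ y)) / t ^ (k + 1)) := by
          have e1 : c * ((ρ / t) ^ k * (1 - ρ / t)) =
              ((t - ρ) / (t ^ (k + 1))) * (c * ρ ^ k) := by
            rw [div_pow, pow_succ]; field_simp
          have e2 : (t - ρ) * ((w ⬝ᵥ ((A ^ k) *ᵥ y)) / t ^ k -
              (w ⬝ᵥ ((A ^ (k + 1)) *ᵥ y)) / t ^ (k + 1)) = ((t - ρ) / (t ^ (k + 1))) *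
              (t * (w ⬝ᵥ ((A ^ k) *ᵥ y)) - w ⬝ᵥ ((A ^ (k + 1)) *ᵥ y)) := by
            rw [pow_succ t k]; field_simp
          rw [e1, e2]
          exact mul_le_mul_of_nonneg_left h1
            (div_nonneg (sub_nonneg.2 ht.le) (pow_pos ht0 _).le)
        have e3 : (ρ / t) ^ (k + 1) = (ρ / t) ^ k * (ρ / t) := pow_succ _ _
        rw [e3]
        linarith
    have hlim1 : Tendsto (fun k : ℕ => c * (1 - (ρ / t) ^ k)) atTop (𝓝 (c * (1 - 0))) :=
      (tendsto_const_nhds.sub (tendsto_pow_atTop_nhds_zero_of_lt_one (div_nonneg hρ0 ht0.le)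
        ((div_lt_one ht0).2 ht))).const_mul c
    have hlim2 : Tendsto (fun k : ℕ => (w ⬝ᵥ ((A ^ k) *ᵥ y)) / t ^ k) atTop (𝓝 0) := by
      have h1 := Matrix.pow_mulVec_isLittleO A (t := t) (fun z hz => (hmax z hz).trans_lt ht) y
      have h2 : (fun k : ℕ => w ⬝ᵥ ((A ^ k) *ᵥ y)) =O[atTop] fun k : ℕ => (A ^ k) *ᵥ y := by
        refine IsBigO.of_bound (∑ i, ‖w i‖) (Eventually.of_forall fun k => ?_)
        rw [dotProduct, Finset.sum_mul]
        refine norm_sum_le_of_le _ fun i _ => ?_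
        rw [norm_mul]
        exact mul_le_mul_of_nonneg_left (norm_le_pi_norm _ i) (norm_nonneg _)
      exact (h2.trans_isLittleO h1).tendsto_div_nhds_zero
    have hlim3 := (tendsto_const_nhds (x := w ⬝ᵥ y)).sub hlim2 |>.const_mul (t - ρ)
    simpa using le_of_tendsto_of_tendsto' hlim1 hlim3 hpartial
  have hcont1 : Continuous fun t : ℝ => (t • (1 : Matrix (Fin d) (Fin d) ℝ) - A).det := by
    fun_prop
  have hcont2 : Continuous fun t : ℝ =>
      w ⬝ᵥ ((t • (1 : Matrix (Fin d) (Fin d) ℝ) - A).adjugate *ᵥ e) := by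
    fun_prop
  rw [Matrix.eval_charpoly_eq_det] at hne
  -- If `ρ` were not an eigenvalue, the resolvent, written as adjugate over determinant, would stay
  -- bounded near `ρ`; the factor `t - ρ` would then push the product below `c`.
  have hlim : Tendsto (fun t : ℝ => (t - ρ) * ((t • (1 : Matrix (Fin d) (Fin d) ℝ) - A).det⁻¹ *
      (w ⬝ᵥ ((t • (1 : Matrix (Fin d) (Fin d) ℝ) - A).adjugate *ᵥ e)))) (𝓝[>] ρ) (𝓝 0) := by
    have h1 : ContinuousAt (fun t : ℝ => (t - ρ) *
        ((t • (1 : Matrix (Fin d) (Fin d) ℝ) - A).det⁻¹ *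
        (w ⬝ᵥ ((t • (1 : Matrix (Fin d) (Fin d) ℝ) - A).adjugate *ᵥ e)))) ρ :=
      (continuousAt_id.sub continuousAt_const).mul
        ((hcont1.continuousAt.inv₀ hne).mul hcont2.continuousAt)
    have h2 := h1.tendsto
    simp only [sub_self, zero_mul] at h2
    exact h2.mono_left nhdsWithin_le_nhds
  refine absurd (ge_of_tendsto hlim ?_) (not_le.2 hc)
  filter_upwards [self_mem_nhdsWithin] with t ht
  have h1 := hresolvent t ht ((t • (1 : Matrix (Fin d) (Fin d) ℝ) - A).det⁻¹ •
    ((t • (1 : Matrix (Fin d) (Fin d) ℝ) - A).adjugate *ᵥ e)) (by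
      set B := t • (1 : Matrix (Fin d) (Fin d) ℝ) - A with hB
      have h2 : ∀ y : Fin d → ℝ, t • y - A *ᵥ y = B *ᵥ y := by
        intro y
        rw [hB, Matrix.sub_mulVec, Matrix.smul_mulVec, Matrix.one_mulVec]
      rw [h2, Matrix.mulVec_smul, Matrix.mulVec_mulVec, Matrix.mul_adjugate, Matrix.smul_mulVec,
        Matrix.one_mulVec, smul_smul, inv_mul_cancel₀ (hdet t ht), one_smul])
  rwa [dotProduct_smul, smul_eq_mul] at h1

/-- Each factor `z - w` over the roots `w` has modulus at least `‖z‖ - r`. This quantitative bound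
replaces continuity of the roots when passing to limits. -/
theorem Matrix.norm_eval_charpoly_ge (M : Matrix n n ℂ) {r : ℝ} {z : ℂ}
    (hr : ∀ w : ℂ, M.charpoly.eval w = 0 → ‖w‖ ≤ r) (hz : r ≤ ‖z‖) :
    (‖z‖ - r) ^ Fintype.card n ≤ ‖M.charpoly.eval z‖ := by
  have hsplit : M.charpoly.Splits := IsAlgClosed.splits _
  have hcard : M.charpoly.roots.card = Fintype.card n := by
    rw [← hsplit.natDegree_eq_card_roots, Matrix.charpoly_natDegree_eq_dim]
  rw [hsplit.eval_eq_prod_roots_of_monic M.charpoly_monic, ← hcard]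
  have hall : ∀ w ∈ M.charpoly.roots, ‖w‖ ≤ r := fun w hw =>
    hr w (Polynomial.isRoot_of_mem_roots hw)
  revert hall
  generalize M.charpoly.roots = s
  intro hall
  induction s using Multiset.induction_on with
  | empty => simp
  | cons a s ih =>
    have h1 := ih fun w hw => hall w (Multiset.mem_cons_of_mem hw)
    have h2 : ‖z‖ - r ≤ ‖z - a‖ :=
      (sub_le_sub_left (hall a (Multiset.mem_cons_self a s)) _).trans (norm_sub_norm_le z a)
    rw [Multiset.map_cons, Multiset.prod_cons, Multiset.card_cons, norm_mul, pow_succ']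
    exact mul_le_mul h2 h1 (pow_nonneg (sub_nonneg.2 hz) _) (norm_nonneg _)

theorem Matrix.exists_bound_eigenvalue (A : Matrix n n ℝ) {r : ℝ} (h : A.charpoly.eval r = 0) :
    |r| ≤ ∑ i, ∑ j, |A i j| := by
  obtain ⟨v, hv, hAv⟩ := A.exists_mulVec_eq_smul_of_eval_charpoly_eq_zero h
  have hpos : 0 < ‖v‖ := norm_pos_iff.2 hv
  refine le_of_mul_le_mul_right ?_ hpos
  rw [← Real.norm_eq_abs, ← norm_smul, ← hAv]
  have hnn : 0 ≤ ∑ i, ∑ j, |A i j| := by positivity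
  refine (pi_norm_le_iff_of_nonneg (by positivity)).2 fun i => ?_
  have h1 : ‖(A *ᵥ v) i‖ ≤ ∑ j, |A i j| * ‖v‖ := by
    refine norm_sum_le_of_le _ fun j _ => ?_
    rw [norm_mul, Real.norm_eq_abs]
    exact mul_le_mul_of_nonneg_left (norm_le_pi_norm v j) (abs_nonneg _)
  refine h1.trans ?_
  rw [← Finset.sum_mul]
  refine mul_le_mul_of_nonneg_right ?_ hpos.le
  exact Finset.single_le_sum (f := fun i => ∑ j, |A i j|) (fun i _ => by positivity)
    (Finset.mem_univ i)

/-- Dominant roots along a convergent sequence are bounded, so a subsequence tends to some `r₀`, a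
root of the limit. A root `z` of the limit with `‖z‖ > r₀` is impossible: the characteristic
polynomials at `z` would stay away from 0. -/
theorem isClosed_setOf_hasDominantRoot : IsClosed {A : Matrix n n ℝ | HasDominantRoot A} := by
  have : FirstCountableTopology (Matrix n n ℝ) :=
    inferInstanceAs (FirstCountableTopology (n → n → ℝ))
  refine isClosed_of_closure_subset fun A hA => ?_
  obtain ⟨X, hX, hlim⟩ := mem_closure_iff_seq_limit.1 hA
  choose r hr0 hr hmax using hX
  have hbdd : ∀ᶠ k in atTop, r k ∈ Set.Icc (0 : ℝ) ((∑ i, ∑ j, |A i j|) + 1) := by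
    have hcont : Continuous fun B : Matrix n n ℝ => ∑ i, ∑ j, |B i j| := by fun_prop
    filter_upwards [((hcont.tendsto A).comp hlim).eventually_lt_const (lt_add_one _)] with k hk
    exact ⟨hr0 k, (le_abs_self _).trans ((Matrix.exists_bound_eigenvalue _ (hr k)).trans hk.le)⟩
  obtain ⟨r₀, hr₀, φ, hφ, hrφ⟩ := isCompact_Icc.tendsto_subseq' hbdd.frequently
  have hXφ := hlim.comp hφ.tendsto_atTop
  refine ⟨r₀, hr₀.1, ?_, fun z hz => ?_⟩
  · rw [Matrix.eval_charpoly_eq_det]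
    have hcont : Continuous fun p : ℝ × Matrix n n ℝ => (p.1 • (1 : Matrix n n ℝ) - p.2).det := by
      fun_prop
    have h1 := (hcont.tendsto (r₀, A)).comp (hrφ.prodMk_nhds hXφ)
    refine tendsto_nhds_unique h1 (tendsto_const_nhds.congr fun k => ?_)
    simpa [Matrix.eval_charpoly_eq_det] using (hr (φ k)).symm
  · by_contra hlt
    rw [not_le] at hlt
    have hcont : Continuous fun B : Matrix n n ℝ =>
        (z • (1 : Matrix n n ℂ) - B.map (algebraMap ℝ ℂ)).det := by
      have : Continuous fun B : Matrix n n ℝ => B.map (algebraMap ℝ ℂ) :=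
        continuous_id.matrix_map Complex.continuous_ofReal
      fun_prop
    have h1 := ((hcont.tendsto A).comp hXφ).norm
    have h2 := (tendsto_const_nhds (x := ‖z‖)).sub hrφ |>.pow (Fintype.card n)
    rw [← Matrix.eval_charpoly_eq_det, hz, norm_zero] at h1
    have h3 : (‖z‖ - r₀) ^ Fintype.card n ≤ 0 := by
      refine le_of_tendsto_of_tendsto h2 h1 ?_
      filter_upwards [hrφ.eventually_lt_const hlt] with k hk
      simp only [Function.comp_apply, ← Matrix.eval_charpoly_eq_det]
      exact Matrix.norm_eval_charpoly_ge _ (hmax (φ k)) hk.le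
    exact absurd h3 (not_le.2 (pow_pos (sub_pos.2 hlt) _))

end Dominant

/-! ### Rank of limits of normalized powers. -/

section Rank

open Filter Topology Asymptotics Matrix

theorem Matrix.exists_rank_factorization {m K : Type*} [Fintype m] [DecidableEq m] [Field K]
    (M : Matrix m m K) :
    ∃ (E : Matrix m (Fin M.rank) K) (F : Matrix (Fin M.rank) m K)
      (E' : Matrix (Fin M.rank) m K) (F' : Matrix m (Fin M.rank) K),
      M = E * F ∧ E' * E = 1 ∧ F * F' = 1 := by
  obtain ⟨V, U, e, hV, hU, h⟩ := M.exists_rank_normal_form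
  have hVdet : IsUnit V.det := (Matrix.isUnit_iff_isUnit_det _).1 hV
  have hUdet : IsUnit U.det := (Matrix.isUnit_iff_isUnit_det _).1 hU
  set E₀ : Matrix m (Fin M.rank) K := (Matrix.fromRows 1 0).submatrix e id with hE₀
  set F₀ : Matrix (Fin M.rank) m K := (Matrix.fromCols 1 0).submatrix id e with hF₀
  have h1 : E₀ * F₀ = (Matrix.fromBlocks 1 0 0 0).submatrix e e := by
    rw [hE₀, hF₀, ← Matrix.submatrix_mul _ _ _ _ _ Function.bijective_id,
      Matrix.fromRows_mul_fromCols]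
    simp
  have h2 : F₀ * E₀ = 1 := by
    rw [hE₀, hF₀, ← Matrix.submatrix_mul _ _ _ _ _ e.bijective, Matrix.fromCols_mul_fromRows]
    simp
  refine ⟨V⁻¹ * E₀, F₀ * U⁻¹, F₀ * V, U * E₀, ?_, ?_, ?_⟩
  · calc M = V⁻¹ * (V * M * U) * U⁻¹ := by
          rw [mul_assoc V M U, Matrix.nonsing_inv_mul_cancel_left _ _ hVdet,
            Matrix.mul_nonsing_inv_cancel_right _ _ hUdet]
      _ = _ := by rw [h, ← h1]; simp only [Matrix.mul_assoc]
  · rw [Matrix.mul_assoc, Matrix.mul_nonsing_inv_cancel_left _ _ hVdet, h2]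
  · rw [Matrix.mul_assoc, Matrix.nonsing_inv_mul_cancel_left _ _ hUdet, h2]

/-- The identity `E' * M * F' = 1` of size `M.rank` survives the change of field. -/
theorem Matrix.rank_le_rank_map {m K K' : Type*} [Fintype m] [DecidableEq m] [Field K] [Field K']
    (f : K →+* K') (M : Matrix m m K) : M.rank ≤ (M.map f).rank := by
  obtain ⟨E, F, E', F', hM, hE, hF⟩ := M.exists_rank_factorization
  have h1 : E' * M * F' = 1 := by
    calc E' * M * F' = E' * (E * F) * F' := by rw [← hM]
      _ = (E' * E) * (F * F') := by simp only [Matrix.mul_assoc]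
      _ = 1 := by rw [hE, hF, Matrix.mul_one]
  have h2 : E'.map f * M.map f * F'.map f = 1 := by
    rw [← Matrix.map_mul, ← Matrix.map_mul, h1, Matrix.map_one f (map_zero f) (map_one f)]
  calc M.rank = (1 : Matrix (Fin M.rank) (Fin M.rank) K').rank := by simp
    _ = (E'.map f * M.map f * F'.map f).rank := by rw [h2]
    _ ≤ (E'.map f * M.map f).rank := Matrix.rank_mul_le_left _ _
    _ ≤ (M.map f).rank := Matrix.rank_mul_le_right _ _

theorem Submodule.finrank_finset_sup_le {ι K V : Type*} [Field K] [AddCommGroup V] [Module K V]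
    [FiniteDimensional K V] (s : Finset ι) (W : ι → Submodule K V) :
    Module.finrank K (s.sup W : Submodule K V) ≤ ∑ i ∈ s, Module.finrank K (W i) := by
  classical
  induction s using Finset.induction_on with
  | empty => simp
  | insert a s ha ih =>
    rw [Finset.sup_insert, Finset.sum_insert ha]
    exact (Submodule.finrank_add_le_finrank_add_finrank _ _).trans (Nat.add_le_add_left ih _)

/-- A map sending each generalized eigenspace of `A` into the span of the leading eigenspaces has
rank at most the expansion index of `A`. -/
theorem rank_le_expansionIndex_of_forall_mem {d : ℕ} (A L : Matrix (Fin d) (Fin d) ℝ)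
    (h : ∀ μ, (complexOperator A).HasEigenvalue μ → ∀ x ∈ (complexOperator A).maxGenEigenspace μ,
      complexOperator L x = 0 ∨ (μ ∈ leadingEigenvalues A ∧
        complexOperator A (complexOperator L x) = μ • complexOperator L x)) :
    L.rank ≤ expansionIndex A := by
  set s := (leadingEigenvalues_finite A).toFinset
  have hrange : LinearMap.range (complexOperator L) ≤
      s.sup fun μ => (complexOperator A).eigenspace μ := by
    rintro _ ⟨x, rfl⟩
    have hx : x ∈ ⨆ μ, (complexOperator A).maxGenEigenspace μ := by
      rw [Module.End.iSup_maxGenEigenspace_eq_top]; trivial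
    induction hx using Submodule.iSup_induction' with
    | mem μ x hx =>
      rcases eq_or_ne x 0 with rfl | hx0
      · simp
      rcases h μ (Module.End.hasEigenvalue_of_mem_maxGenEigenspace hx hx0) x hx with h0 | ⟨hμ, he⟩
      · rw [h0]; exact Submodule.zero_mem _
      · have hμs : μ ∈ s := (leadingEigenvalues_finite A).mem_toFinset.2 hμ
        exact Finset.le_sup (f := fun μ => (complexOperator A).eigenspace μ) hμs
          (Module.End.mem_eigenspace_iff.2 he)
    | zero => simp
    | add x y _ _ hx hy => rw [map_add]; exact Submodule.add_mem _ hx hy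
  calc L.rank ≤ (L.map (algebraMap ℝ ℂ)).rank := L.rank_le_rank_map _
    _ = Module.finrank ℂ (LinearMap.range (complexOperator L)) := rfl
    _ ≤ Module.finrank ℂ (s.sup fun μ => (complexOperator A).eigenspace μ :
          Submodule ℂ (Fin d → ℂ)) := Submodule.finrank_mono hrange
    _ ≤ expansionIndex A := Submodule.finrank_finset_sup_le _ _

theorem complexOperator_pow {d : ℕ} (A : Matrix (Fin d) (Fin d) ℝ) (k : ℕ) :
    complexOperator (A ^ k) = complexOperator A ^ k := by
  have : (A ^ k).map (fun a : ℝ => (a : ℂ)) = (A.map (fun a : ℝ => (a : ℂ))) ^ k :=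
    Matrix.map_pow A (algebraMap ℝ ℂ) k
  rw [complexOperator, complexOperator, this, Matrix.toLin'_pow]

theorem complexOperator_smul {d : ℕ} (c : ℝ) (A : Matrix (Fin d) (Fin d) ℝ) :
    complexOperator (c • A) = (c : ℂ) • complexOperator A := by
  rw [complexOperator, complexOperator, ← map_smul]
  congr 1
  ext i j
  simp

theorem complexOperator_injective {d : ℕ} :
    Function.Injective (complexOperator (d := d)) := by
  intro A B h
  have := Matrix.toLin'.injective h
  exact Matrix.map_injective Complex.ofReal_injective this

theorem continuous_complexOperator_apply {d : ℕ} (x : Fin d → ℂ) :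
    Continuous fun A : Matrix (Fin d) (Fin d) ℝ => complexOperator A x := by
  have h : Continuous fun B : Matrix (Fin d) (Fin d) ℝ => B.map (fun a : ℝ => (a : ℂ)) :=
    continuous_id.matrix_map Complex.continuous_ofReal
  have : (fun A : Matrix (Fin d) (Fin d) ℝ => complexOperator A x) =
      fun A => A.map (fun a : ℝ => (a : ℂ)) *ᵥ x := by
    ext A; simp [complexOperator]
  rw [this]
  fun_prop

theorem exists_hasEigenvalue_norm_max {d : ℕ} [NeZero d] (A : Matrix (Fin d) (Fin d) ℝ) :
    ∃ z, (complexOperator A).HasEigenvalue z ∧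
      ∀ μ, (complexOperator A).HasEigenvalue μ → ‖μ‖ ≤ ‖z‖ := by
  obtain ⟨z, hz, hmax⟩ := Matrix.exists_root_norm_max (A.map (algebraMap ℝ ℂ))
  exact ⟨z, (Matrix.hasEigenvalue_toLin'_iff _ _).2 hz,
    fun μ hμ => hmax μ ((Matrix.hasEigenvalue_toLin'_iff _ _).1 hμ)⟩

theorem Module.End.isNilpotent_of_forall_hasEigenvalue_eq_zero {K V : Type*} [Field K]
    [IsAlgClosed K] [AddCommGroup V] [Module K V] [FiniteDimensional K V] (f : Module.End K V)
    (h : ∀ μ, f.HasEigenvalue μ → μ = 0) : IsNilpotent f := by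
  refine ⟨Module.finrank K V, LinearMap.ext fun x => ?_⟩
  have hx : x ∈ ⨆ μ, f.maxGenEigenspace μ := by
    rw [Module.End.iSup_maxGenEigenspace_eq_top]; trivial
  have hle : ⨆ μ, f.maxGenEigenspace μ ≤ f.maxGenEigenspace 0 := by
    refine iSup_le fun μ x hx => ?_
    rcases eq_or_ne x 0 with rfl | hx0
    · exact Submodule.zero_mem _
    · rwa [h μ (Module.End.hasEigenvalue_of_mem_maxGenEigenspace hx hx0)] at hx
  have h0 := hle hx
  rw [Module.End.maxGenEigenspace_eq_genEigenspace_finrank] at h0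
  simpa using Module.End.mem_genEigenspace_nat.1 h0

theorem complexOperator_pow_apply_isBigO_of_tendsto {d : ℕ} (A L : Matrix (Fin d) (Fin d) ℝ) {φ : ℕ → ℕ}
    {a : ℕ → ℝ} (ha : ∀ k, 0 < a k)
    (hlim : Tendsto (fun k => (a k)⁻¹ • A ^ φ k) atTop (𝓝 L)) (x : Fin d → ℂ) :
    (fun k => (complexOperator A ^ φ k) x) =O[atTop] a := by
  have h1 := ((continuous_complexOperator_apply x).tendsto L).comp hlim
  have h2 := h1.isBigO_one ℝ
  rw [isBigO_iff] at h2 ⊢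
  obtain ⟨c, hc⟩ := h2
  refine ⟨c, hc.mono fun k hk => ?_⟩
  rw [Function.comp_apply, complexOperator_smul, complexOperator_pow, LinearMap.smul_apply,
    norm_smul, Complex.norm_real, norm_inv, norm_one, mul_one,
    inv_mul_le_iff₀ (norm_pos_iff.2 (ha k).ne'), mul_comm] at hk
  exact hk

/-- Convergence forces `A ^ φ k x = O(a k)`; on an eigenvector for `z` of maximal modulus this reads
`‖z‖ ^ φ k = O(a k)`. So vectors of smaller growth are killed by `L`, while on a leading generalized
eigenspace `(A - μ) A ^ φ k x = o(a k)` puts `L x` in the eigenspace. -/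
theorem rank_le_expansionIndex_of_tendsto {d : ℕ} [NeZero d] (A L : Matrix (Fin d) (Fin d) ℝ)
    (hA : ¬ IsNilpotent A) {φ : ℕ → ℕ} (hφ : Tendsto φ atTop atTop) {a : ℕ → ℝ}
    (ha : ∀ k, 0 < a k) (hlim : Tendsto (fun k => (a k)⁻¹ • A ^ φ k) atTop (𝓝 L)) :
    L.rank ≤ expansionIndex A := by
  obtain ⟨z, hz, hmax⟩ := exists_hasEigenvalue_norm_max A
  have hz0 : z ≠ 0 := by
    rintro rfl
    obtain ⟨k, hk⟩ := Module.End.isNilpotent_of_forall_hasEigenvalue_eq_zero (complexOperator A)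
      fun μ hμ => by simpa using hmax μ hμ
    refine hA ⟨k, complexOperator_injective ?_⟩
    rw [complexOperator_pow, hk]
    ext; simp [complexOperator]
  have hbig := complexOperator_pow_apply_isBigO_of_tendsto A L ha hlim
  have hconv : ∀ x, Tendsto (fun k => ((a k)⁻¹ : ℂ) • (complexOperator A ^ φ k) x) atTop
      (𝓝 (complexOperator L x)) := by
    intro x
    refine (((continuous_complexOperator_apply x).tendsto L).comp hlim).congr fun k => ?_
    rw [Function.comp_apply, complexOperator_smul, complexOperator_pow, LinearMap.smul_apply,
      Complex.ofReal_inv]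
  have hsmall : ∀ y : ℕ → Fin d → ℂ, y =o[atTop] a →
      Tendsto (fun k => ((a k)⁻¹ : ℂ) • y k) atTop (𝓝 0) := by
    intro y hy
    rw [← isLittleO_one_iff ℝ]
    rw [isLittleO_iff] at hy ⊢
    intro c hc
    filter_upwards [hy hc] with k hk
    rw [norm_smul, norm_inv, Complex.norm_real, norm_one, mul_one,
      inv_mul_le_iff₀ (norm_pos_iff.2 (ha k).ne'), mul_comm]
    exact hk
  refine rank_le_expansionIndex_of_forall_mem A L fun μ hμ x hx => ?_
  rcases (hmax μ hμ).lt_or_eq with hlt | heq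
  · left
    obtain ⟨u, hu⟩ := hz.exists_hasEigenvector
    have h1 : (fun k => ‖z‖ ^ φ k) =O[atTop] a := by
      refine IsBigO.trans ?_ (hbig u)
      refine IsBigO.of_bound ‖u‖⁻¹ (Eventually.of_forall fun k => ?_)
      rw [hu.pow_apply, norm_smul, norm_pow, norm_pow, norm_norm, mul_comm ‖u‖⁻¹, mul_assoc,
        mul_inv_cancel₀ (norm_ne_zero_iff.2 hu.2), mul_one]
    have h2 := (pow_apply_isLittleO_of_mem_maxGenEigenspace _ hlt hx).comp_tendsto hφ
    exact tendsto_nhds_unique (hconv x) (hsmall _ (h2.trans_isBigO h1))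
  · right
    have hμ0 : μ ≠ 0 := by rw [← norm_ne_zero_iff, heq, norm_ne_zero_iff]; exact hz0
    refine ⟨⟨hμ, fun ν hν => heq ▸ hmax ν hν⟩, ?_⟩
    have h2 := (sub_smul_pow_apply_isLittleO _ hμ0 hx).comp_tendsto hφ
    have h3 := hsmall _ (h2.trans_isBigO (hbig x))
    set N := complexOperator A - algebraMap ℂ (Module.End ℂ (Fin d → ℂ)) μ with hN
    have h4 := (N.continuous_of_finiteDimensional.tendsto _).comp (hconv x)
    have h5 : N (complexOperator L x) = 0 := by
      refine tendsto_nhds_unique h4 (h3.congr fun k => ?_)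
      simp
    rw [hN, LinearMap.sub_apply, Module.algebraMap_end_apply, sub_eq_zero] at h5
    exact h5

theorem rank_le_expansionIndex_of_isNilpotent {d : ℕ} [NeZero d] {A : Matrix (Fin d) (Fin d) ℝ}
    (hA : IsNilpotent A) {L : Matrix (Fin d) (Fin d) ℝ} (hL : A * L = 0) :
    L.rank ≤ expansionIndex A := by
  obtain ⟨k, hk⟩ := hA
  have h0 : ∀ μ, (complexOperator A).HasEigenvalue μ → μ = 0 := by
    intro μ hμ
    obtain ⟨u, hu⟩ := hμ.exists_hasEigenvector
    have h1 := hu.pow_apply k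
    rw [← complexOperator_pow, hk] at h1
    have h2 : complexOperator (0 : Matrix (Fin d) (Fin d) ℝ) u = 0 := by simp [complexOperator]
    rw [h2] at h1
    exact eq_zero_of_pow_eq_zero ((smul_eq_zero.1 h1.symm).resolve_right hu.2)
  refine rank_le_expansionIndex_of_forall_mem A L fun μ hμ x _ => Or.inr ⟨⟨hμ, fun ν hν => ?_⟩, ?_⟩
  · rw [h0 μ hμ, h0 ν hν]
  · rw [h0 μ hμ, zero_smul]
    have : (A.map (algebraMap ℝ ℂ)) * (L.map (algebraMap ℝ ℂ)) = 0 := by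
      rw [← Matrix.map_mul, hL, Matrix.map_zero _ (map_zero _)]
    change Matrix.toLin' (A.map (algebraMap ℝ ℂ)) (Matrix.toLin' (L.map (algebraMap ℝ ℂ)) x) = 0
    rw [Matrix.toLin'_apply, Matrix.toLin'_apply, Matrix.mulVec_mulVec, this, Matrix.zero_mulVec]

open scoped Matrix.Norms.Operator in
/-- The closed cone of powers of `A` contains a nonzero matrix of rank at most the expansion
index. -/
theorem exists_mem_closure_rank_le_expansionIndex {d : ℕ} [NeZero d]
    (A : Matrix (Fin d) (Fin d) ℝ) :
    ∃ L ∈ closure {X : Matrix (Fin d) (Fin d) ℝ | ∃ c : ℝ, 0 ≤ c ∧ ∃ k : ℕ, X = c • A ^ k},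
      L ≠ 0 ∧ L.rank ≤ expansionIndex A := by
  classical
  by_cases hA : IsNilpotent A
  -- In the nilpotent case the last nonzero power serves: its range lies in the kernel of `A`, the
  -- eigenspace of the only eigenvalue 0.
  · have hex : ∃ k, A ^ k = 0 := hA
    have hpos : Nat.find hex ≠ 0 := by
      intro h0
      have := Nat.find_spec hex
      rw [h0, pow_zero] at this
      exact one_ne_zero this
    obtain ⟨j, hj⟩ := Nat.exists_eq_succ_of_ne_zero hpos
    refine ⟨A ^ j, subset_closure ⟨1, zero_le_one, j, (one_smul _ _).symm⟩,
      Nat.find_min hex (by omega), rank_le_expansionIndex_of_isNilpotent hA ?_⟩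
    rw [← pow_succ']
    simpa [hj] using Nat.find_spec hex
  · have hne : ∀ k, A ^ k ≠ 0 := fun k hk => hA ⟨k, hk⟩
    have hmem : ∀ k, (‖A ^ k‖⁻¹ • A ^ k) ∈ Metric.sphere (0 : Matrix (Fin d) (Fin d) ℝ) 1 := by
      intro k
      rw [mem_sphere_zero_iff_norm, norm_smul, norm_inv, norm_norm,
        inv_mul_cancel₀ (norm_ne_zero_iff.2 (hne k))]
    have : ProperSpace (Matrix (Fin d) (Fin d) ℝ) := FiniteDimensional.proper_real _
    obtain ⟨L, hL, φ, hφ, hlim⟩ := (isCompact_sphere _ _).tendsto_subseq hmem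
    refine ⟨L, ?_, ?_, ?_⟩
    · exact mem_closure_of_tendsto hlim (Eventually.of_forall fun k =>
        ⟨_, inv_nonneg.2 (norm_nonneg _), φ k, rfl⟩)
    · rintro rfl
      simp at hL
    · exact rank_le_expansionIndex_of_tendsto A L hA hφ.tendsto_atTop
        (fun k => norm_pos_iff.2 (hne (φ k))) hlim

end Rank

/-! ### Semigroups of invertible matrices in dimensions one and two. -/

section Small

open Filter Topology Asymptotics Matrix

/-- Both products have the same nonzero eigenvalues. If the dominant root is 0, all roots of `G * E`
vanish, and one exists because `n` is nonempty. -/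
theorem HasDominantRoot.mul_comm {m n : Type*} [Fintype m] [DecidableEq m] [Fintype n]
    [DecidableEq n] [Nonempty n] {E : Matrix m n ℝ} {G : Matrix n m ℝ}
    (h : HasDominantRoot (E * G)) : HasDominantRoot (G * E) := by
  obtain ⟨r, hr0, hr, hmax⟩ := h
  have hcomplex : ∀ z : ℂ, ((G * E).map (algebraMap ℝ ℂ)).charpoly.eval z = 0 → ‖z‖ ≤ r := by
    intro z hz
    rcases eq_or_ne z 0 with rfl | hz0
    · simpa using hr0
    refine hmax z ?_
    have h1 := congrArg (Polynomial.eval z)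
      (Matrix.charpoly_mul_comm' (E.map (algebraMap ℝ ℂ)) (G.map (algebraMap ℝ ℂ)))
    rw [← Matrix.map_mul, ← Matrix.map_mul] at h1
    simp only [Polynomial.eval_mul, Polynomial.eval_pow, Polynomial.eval_X] at h1
    rw [hz, mul_zero] at h1
    exact (mul_eq_zero.1 h1).resolve_left (pow_ne_zero _ hz0)
  refine ⟨r, hr0, ?_, hcomplex⟩
  rcases eq_or_ne r 0 with rfl | hr0'
  · obtain ⟨z, hz, -⟩ := Matrix.exists_root_norm_max ((G * E).map (algebraMap ℝ ℂ))
    have hz0 : z = ((0 : ℝ) : ℂ) := by simpa using hcomplex z hz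
    rw [hz0, Matrix.eval_charpoly_map_ofReal] at hz
    exact_mod_cast hz
  · have h1 := congrArg (Polynomial.eval r) (Matrix.charpoly_mul_comm' E G)
    simp only [Polynomial.eval_mul, Polynomial.eval_pow, Polynomial.eval_X] at h1
    rw [hr, mul_zero] at h1
    exact (mul_eq_zero.1 h1.symm).resolve_left (pow_ne_zero _ hr0')

theorem hasDominantRoot_smul_one {n : Type*} [Fintype n] [DecidableEq n] [Nonempty n] {c : ℝ}
    (hc : 0 ≤ c) : HasDominantRoot (c • (1 : Matrix n n ℝ)) := by
  refine ⟨c, hc, ?_, fun z hz => ?_⟩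
  · exact Matrix.eval_charpoly_eq_zero_of_mulVec_eq_smul _ (v := fun _ => 1)
      (fun h => one_ne_zero (congrFun h (Classical.arbitrary n))) (by simp [Matrix.smul_mulVec])
  · obtain ⟨v, hv, h⟩ := Matrix.exists_mulVec_eq_smul_of_eval_charpoly_eq_zero _ hz
    have hmap : (c • (1 : Matrix n n ℝ)).map (algebraMap ℝ ℂ) = (c : ℂ) • (1 : Matrix n n ℂ) := by
      ext i j
      by_cases hij : i = j <;> simp [hij]
    rw [hmap, Matrix.smul_mulVec, Matrix.one_mulVec, ← sub_eq_zero, ← sub_smul] at h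
    have hz : (c : ℂ) = z := sub_eq_zero.1 ((smul_eq_zero.1 h).resolve_right hv)
    rw [← hz, Complex.norm_real, Real.norm_of_nonneg hc]

theorem eval_charpoly_fin_two (C : Matrix (Fin 2) (Fin 2) ℝ) (t : ℝ) :
    C.charpoly.eval t = t ^ 2 - C.trace * t + C.det := by
  rw [Matrix.charpoly_fin_two]; simp

theorem sq_eq_fin_two (C : Matrix (Fin 2) (Fin 2) ℝ) :
    C * C = C.trace • C - C.det • (1 : Matrix (Fin 2) (Fin 2) ℝ) := by
  ext i j
  fin_cases i <;> fin_cases j <;>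
    simp [Matrix.mul_apply, Fin.sum_univ_two, Matrix.trace_fin_two, Matrix.det_fin_two] <;> ring

/-- Both eigenvalues of a real `2 × 2` matrix with dominant root and `|det| = 1` have modulus one
as soon as the dominant root is at most one. -/
theorem HasDominantRoot.fin_two_of_abs_det_eq_one {C : Matrix (Fin 2) (Fin 2) ℝ}
    (h : HasDominantRoot C) (hdet : |C.det| = 1)
    (hle : ∀ r : ℝ, C.charpoly.eval r = 0 → r ≤ 1) : C.charpoly.eval 1 = 0 := by
  obtain ⟨r, hr0, hr, hmax⟩ := h
  have hr1 := hle r hr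
  have hr' := hr
  rw [eval_charpoly_fin_two] at hr'
  have hl : C.charpoly.eval (C.trace - r) = 0 := by
    rw [eval_charpoly_fin_two]; linarith
  have hl' := hmax ((C.trace - r : ℝ) : ℂ) (by rw [Matrix.eval_charpoly_map_ofReal, hl]; simp)
  rw [Complex.norm_real, Real.norm_eq_abs] at hl'
  have hprod : r * |C.trace - r| = 1 := by
    rw [← hdet, ← abs_of_nonneg hr0, ← abs_mul, abs_of_nonneg hr0]
    congr 1; linarith
  have : r = 1 := by nlinarith [abs_nonneg (C.trace - r)]
  rwa [this] at hr

/-- The powers are `1 + k • N`, which grow linearly unless `N = 0`. -/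
theorem eq_one_of_unipotent_of_powers_bounded {C N : Matrix (Fin 2) (Fin 2) ℝ} (hC : C = 1 + N)
    (hN : N * N = 0) {M : ℝ} (hM : ∀ k : ℕ, ∀ i j, |(C ^ k) i j| ≤ M) : C = 1 := by
  have hpow : ∀ k : ℕ, C ^ k = 1 + (k : ℝ) • N := by
    intro k
    induction k with
    | zero => simp
    | succ k ih =>
      rw [pow_succ, ih, hC, mul_add, mul_one, add_mul, one_mul, smul_mul_assoc, hN, smul_zero,
        add_zero, add_assoc, Nat.cast_succ, add_smul, one_smul]
  suffices N = 0 by rw [hC, this, add_zero]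
  ext i j
  by_contra hne
  rw [Matrix.zero_apply] at hne
  obtain ⟨k, hk⟩ := exists_nat_gt ((M + 1) / |N i j|)
  rw [div_lt_iff₀ (abs_pos.2 hne)] at hk
  have h1 := hM k i j
  rw [hpow, Matrix.add_apply, Matrix.smul_apply, smul_eq_mul] at h1
  have h2 : |(1 : Matrix (Fin 2) (Fin 2) ℝ) i j| ≤ 1 := by
    by_cases hij : i = j <;> simp [Matrix.one_apply, hij]
  have h3 : (k : ℝ) * |N i j| ≤ M + 1 := by
    have : (k : ℝ) * |N i j| = |(k : ℝ) * N i j| := by rw [abs_mul, Nat.abs_cast]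
    rw [this]
    calc |(k : ℝ) * N i j| = |((1 : Matrix (Fin 2) (Fin 2) ℝ) i j + k * N i j) -
          (1 : Matrix (Fin 2) (Fin 2) ℝ) i j| := by congr 1; ring
      _ ≤ _ := abs_sub _ _
      _ ≤ M + 1 := add_le_add h1 h2
  linarith

-- On the compact unit sphere of `T` the determinant is bounded below by some `m > 0` in modulus; by
-- homogeneity of degree 2, `|det C| = 1` gives `‖C‖ ^ 2 ≤ m⁻¹`.
open scoped Matrix.Norms.Operator in
theorem exists_entry_bound_of_abs_det_eq_one {T : Set (Matrix (Fin 2) (Fin 2) ℝ)}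
    (hclosed : IsClosed T) (hsmul : ∀ c : ℝ, 0 ≤ c → ∀ C ∈ T, c • C ∈ T)
    (hdet : ∀ C ∈ T, C ≠ 0 → C.det ≠ 0) :
    ∃ M : ℝ, ∀ C ∈ T, |C.det| = 1 → ∀ i j, |C i j| ≤ M := by
  have : ProperSpace (Matrix (Fin 2) (Fin 2) ℝ) := FiniteDimensional.proper_real _
  have hcomp : IsCompact (T ∩ Metric.sphere (0 : Matrix (Fin 2) (Fin 2) ℝ) 1) :=
    (isCompact_sphere _ _).inter_left hclosed
  have hmem : ∀ C ∈ T, C ≠ 0 → ‖C‖⁻¹ • C ∈ T ∩ Metric.sphere (0 : Matrix (Fin 2) (Fin 2) ℝ) 1 := by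
    intro C hC hC0
    refine ⟨hsmul _ (inv_nonneg.2 (norm_nonneg _)) C hC, ?_⟩
    rw [mem_sphere_zero_iff_norm, norm_smul, norm_inv, norm_norm,
      inv_mul_cancel₀ (norm_ne_zero_iff.2 hC0)]
  have hpos : ∃ m : ℝ, 0 < m ∧ ∀ C ∈ T ∩ Metric.sphere (0 : Matrix (Fin 2) (Fin 2) ℝ) 1,
      m ≤ |C.det| := by
    rcases (T ∩ Metric.sphere (0 : Matrix (Fin 2) (Fin 2) ℝ) 1).eq_empty_or_nonempty with h | h
    · exact ⟨1, one_pos, by simp [h]⟩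
    · obtain ⟨C₀, hC₀, hmin⟩ := hcomp.exists_isMinOn h
        (f := fun C : Matrix (Fin 2) (Fin 2) ℝ => |C.det|) (by fun_prop)
      refine ⟨|C₀.det|, abs_pos.2 (hdet _ hC₀.1 ?_), fun C hC => hmin hC⟩
      rintro rfl
      simpa using hC₀.2
  obtain ⟨m, hm, hmin⟩ := hpos
  obtain ⟨κ, hκ⟩ : ∃ κ : ℝ, ∀ C ∈ Metric.sphere (0 : Matrix (Fin 2) (Fin 2) ℝ) 1,
      ∀ i j, |C i j| ≤ κ := by
    have hb : ∀ i j, ∃ κ : ℝ, ∀ C ∈ Metric.sphere (0 : Matrix (Fin 2) (Fin 2) ℝ) 1,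
        |C i j| ≤ κ := by
      intro i j
      obtain ⟨κ, hκ⟩ :=
        (isCompact_sphere (0 : Matrix (Fin 2) (Fin 2) ℝ) 1).exists_bound_of_continuousOn
        (f := fun C : Matrix (Fin 2) (Fin 2) ℝ => C i j) (by fun_prop)
      exact ⟨κ, fun C hC => hκ C hC⟩
    choose κ hκ using hb
    refine ⟨∑ i, ∑ j, |κ i j|, fun C hC i j => (hκ i j C hC).trans ((le_abs_self _).trans ?_)⟩
    exact (Finset.single_le_sum (f := fun j => |κ i j|) (fun _ _ => abs_nonneg _)
      (Finset.mem_univ j)).trans (Finset.single_le_sum (f := fun i => ∑ j, |κ i j|)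
      (fun _ _ => by positivity) (Finset.mem_univ i))
  refine ⟨(1 + m⁻¹) * |κ|, fun C hC hC1 i j => ?_⟩
  have hC0 : C ≠ 0 := by
    rintro rfl
    simp at hC1
  have hn : 0 < ‖C‖ := norm_pos_iff.2 hC0
  have h1 := hmin _ (hmem C hC hC0)
  rw [Matrix.det_smul, abs_mul, hC1, mul_one, Fintype.card_fin, abs_of_nonneg (by positivity),
    inv_pow] at h1
  have h2 : ‖C‖ ≤ 1 + m⁻¹ := by
    have h3 : ‖C‖ ^ 2 ≤ m⁻¹ := (le_inv_comm₀ hm (by positivity)).1 h1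
    nlinarith [sq_nonneg (‖C‖ - 1)]
  have h4 := (hκ _ (hmem C hC hC0).2 i j).trans (le_abs_self κ)
  rw [Matrix.smul_apply, smul_eq_mul, abs_mul, abs_of_nonneg (inv_nonneg.2 hn.le),
    inv_mul_le_iff₀ hn] at h4
  exact h4.trans (mul_le_mul_of_nonneg_right h2 (abs_nonneg _))

theorem exists_forall_eq_smul_of_fin_two {T : Set (Matrix (Fin 2) (Fin 2) ℝ)}
    (hclosed : IsClosed T) (hmul : ∀ C ∈ T, ∀ C' ∈ T, C * C' ∈ T)
    (hsmul : ∀ c : ℝ, 0 ≤ c → ∀ C ∈ T, c • C ∈ T)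
    (hdom : ∀ C ∈ T, HasDominantRoot C) (hdet : ∀ C ∈ T, C ≠ 0 → C.det ≠ 0) :
    ∃ R : Matrix (Fin 2) (Fin 2) ℝ, R.charpoly.eval 1 = 0 ∧
      ∀ C ∈ T, ∃ c : ℝ, 0 ≤ c ∧ (C = c • 1 ∨ C = c • R) := by
  obtain ⟨M, hM⟩ := exists_entry_bound_of_abs_det_eq_one hclosed hsmul hdet
  have hpowmem : ∀ C ∈ T, ∀ k : ℕ, C ^ (k + 1) ∈ T := by
    intro C hC k
    induction k with
    | zero => simpa
    | succ k ih => rw [pow_succ]; exact hmul _ ih _ hC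
  -- The maximum with 1 covers the zeroth power, since the identity need not lie in `T`.
  have hpow : ∀ C ∈ T, |C.det| = 1 → ∀ k : ℕ, ∀ i j, |(C ^ k) i j| ≤ max M 1 := by
    intro C hC hC1 k i j
    rcases k with _ | k
    · refine le_trans ?_ (le_max_right _ _)
      by_cases hij : i = j <;> simp [hij]
    · refine (hM _ (hpowmem C hC k) ?_ i j).trans (le_max_left _ _)
      rw [Matrix.det_pow, abs_pow, hC1, one_pow]
  have hroot : ∀ C ∈ T, |C.det| = 1 → C.charpoly.eval 1 = 0 := by
    intro C hC hC1
    refine (hdom C hC).fin_two_of_abs_det_eq_one hC1 fun r hr => ?_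
    by_contra hlt
    rw [not_le] at hlt
    obtain ⟨v, hv, hCv⟩ := C.exists_mulVec_eq_smul_of_eval_charpoly_eq_zero hr
    obtain ⟨k, hk⟩ := pow_unbounded_of_one_lt (∑ _i : Fin 2, ∑ _j : Fin 2, max M 1) hlt
    have hCk : (C ^ k) *ᵥ v = r ^ k • v := by
      clear hk
      induction k with
      | zero => simp
      | succ k ih => rw [pow_succ', ← Matrix.mulVec_mulVec, ih, Matrix.mulVec_smul, hCv, smul_smul,
          pow_succ]
    have h1 := Matrix.exists_bound_eigenvalue _
      (Matrix.eval_charpoly_eq_zero_of_mulVec_eq_smul _ hv hCk)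
    have h2 : ∑ i, ∑ j, |(C ^ k) i j| ≤ ∑ _i : Fin 2, ∑ _j : Fin 2, max M 1 :=
      Finset.sum_le_sum fun i _ => Finset.sum_le_sum fun j _ => hpow C hC hC1 k i j
    exact absurd ((le_abs_self _).trans (h1.trans h2)) (not_le.2 hk)
  -- Eigenvalue 1 and determinant 1 give trace 2, so Cayley–Hamilton yields `(C - 1) ^ 2 = 0`, and
  -- bounded powers finish.
  have hone : ∀ C ∈ T, C.det = 1 → C = 1 := by
    intro C hC hC1
    have habs : |C.det| = 1 := by rw [hC1, abs_one]
    have htr := hroot C hC habs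
    rw [eval_charpoly_fin_two, hC1] at htr
    have htr' : C.trace = 2 := by linarith
    have hsq := sq_eq_fin_two C
    rw [htr', hC1] at hsq
    refine eq_one_of_unipotent_of_powers_bounded (N := C - 1) (by abel) ?_ (hpow C hC habs)
    rw [sub_mul, mul_sub, hsq, mul_one, one_mul, one_smul, two_smul]
    abel
  have hinv : ∀ C ∈ T, C.det = -1 → C * C = 1 := by
    intro C hC hC1
    exact hone _ (hmul C hC C hC) (by rw [Matrix.det_mul, hC1]; norm_num)
  have hscale : ∀ C ∈ T, C ≠ 0 → ∃ c : ℝ, 0 < c ∧ ∃ G ∈ T,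
      (G.det = 1 ∨ G.det = -1) ∧ C = c • G := by
    intro C hC hC0
    have hpos : 0 < |C.det| := abs_pos.2 (hdet C hC hC0)
    set s := Real.sqrt |C.det| with hs
    have hs0 : 0 < s := Real.sqrt_pos.2 hpos
    refine ⟨s, hs0, s⁻¹ • C, hsmul _ (inv_nonneg.2 hs0.le) C hC, ?_, ?_⟩
    · rw [← abs_eq zero_le_one, Matrix.det_smul, abs_mul, Fintype.card_fin, inv_pow,
        Real.sq_sqrt hpos.le, abs_inv, abs_abs, inv_mul_cancel₀ hpos.ne']
    · rw [smul_smul, mul_inv_cancel₀ hs0.ne', one_smul]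
  -- Any two elements of determinant `-1` have product 1 and square 1, hence are equal.
  by_cases hR : ∃ R ∈ T, R.det = -1
  · obtain ⟨R, hRT, hR1⟩ := hR
    refine ⟨R, hroot R hRT (by rw [hR1]; norm_num), fun C hC => ?_⟩
    rcases eq_or_ne C 0 with rfl | hC0
    · exact ⟨0, le_rfl, Or.inl (by simp)⟩
    obtain ⟨c, hc, G, hG, hG1 | hG1, rfl⟩ := hscale C hC hC0
    · exact ⟨c, hc.le, Or.inl (by rw [hone G hG hG1])⟩
    · refine ⟨c, hc.le, Or.inr ?_⟩
      have h1 : G * R = 1 := hone _ (hmul G hG R hRT) (by rw [Matrix.det_mul, hG1, hR1]; norm_num)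
      have h2 : G = R := by
        calc G = G * (R * R) := by rw [hinv R hRT hR1, mul_one]
          _ = R := by rw [← mul_assoc, h1, one_mul]
      rw [h2]
  · refine ⟨1, by rw [eval_charpoly_fin_two]; simp; norm_num,
      fun C hC => ?_⟩
    rcases eq_or_ne C 0 with rfl | hC0
    · exact ⟨0, le_rfl, Or.inl (by simp)⟩
    obtain ⟨c, hc, G, hG, hG1 | hG1, rfl⟩ := hscale C hC hC0
    · exact ⟨c, hc.le, Or.inl (by rw [hone G hG hG1])⟩
    · exact absurd ⟨G, hG, hG1⟩ hR

theorem exists_dotProduct_nonneg_of_fin_two {T : Set (Matrix (Fin 2) (Fin 2) ℝ)}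
    (hclosed : IsClosed T) (hmul : ∀ C ∈ T, ∀ C' ∈ T, C * C' ∈ T)
    (hsmul : ∀ c : ℝ, 0 ≤ c → ∀ C ∈ T, c • C ∈ T)
    (hdom : ∀ C ∈ T, HasDominantRoot C) (hdet : ∀ C ∈ T, C ≠ 0 → C.det ≠ 0) :
    ∃ v w : Fin 2 → ℝ, v ≠ 0 ∧ w ≠ 0 ∧ ∀ C ∈ T, 0 ≤ w ⬝ᵥ (C *ᵥ v) := by
  obtain ⟨R, hR, hT⟩ := exists_forall_eq_smul_of_fin_two hclosed hmul hsmul hdom hdet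
  obtain ⟨v, hv, hRv⟩ := R.exists_mulVec_eq_smul_of_eval_charpoly_eq_zero hR
  rw [one_smul] at hRv
  obtain ⟨w, hw, hwv⟩ : ∃ w : Fin 2 → ℝ, w ≠ 0 ∧ 0 ≤ w ⬝ᵥ v :=
    ⟨v, hv, Finset.sum_nonneg fun i _ => mul_self_nonneg _⟩
  refine ⟨v, w, hv, hw, fun C hC => ?_⟩
  obtain ⟨c, hc, rfl | rfl⟩ := hT C hC
  · rw [Matrix.smul_mulVec, Matrix.one_mulVec, dotProduct_smul]
    exact mul_nonneg hc hwv
  · rw [Matrix.smul_mulVec, hRv, dotProduct_smul]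
    exact mul_nonneg hc hwv

theorem exists_dotProduct_nonneg_of_fin_one {T : Set (Matrix (Fin 1) (Fin 1) ℝ)}
    (hdom : ∀ C ∈ T, HasDominantRoot C) :
    ∃ v w : Fin 1 → ℝ, v ≠ 0 ∧ w ≠ 0 ∧ ∀ C ∈ T, 0 ≤ w ⬝ᵥ (C *ᵥ v) := by
  refine ⟨fun _ => 1, fun _ => 1, fun h => one_ne_zero (congrFun h 0),
    fun h => one_ne_zero (congrFun h 0), fun C hC => ?_⟩
  obtain ⟨r, hr0, hr, -⟩ := hdom C hC
  rw [Matrix.eval_charpoly_eq_det, Matrix.det_fin_one] at hr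
  have : r = C 0 0 := by simpa [sub_eq_zero] using hr
  simpa [Matrix.mulVec, dotProduct, ← this] using hr0

end Small

/-! ### From an orbit in a half-space to an invariant cone. -/

section Cone

open Filter Topology Asymptotics Matrix

/-- An irreducible semigroup leaves a cone invariant as soon as some orbit, together with its base
point, stays in a closed half-space. -/
theorem exists_invariant_cone_of_orbit_nonneg {d : ℕ}
    {S : Subsemigroup (Matrix (Fin d) (Fin d) ℝ)} (hirr : IsIrreducibleSemigroup S)
    {x g : Fin d → ℝ} (hx : x ≠ 0) (hg : g ≠ 0) (hgx : 0 ≤ g ⬝ᵥ x)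
    (hgS : ∀ B ∈ S, 0 ≤ g ⬝ᵥ (B *ᵥ x)) :
    ∃ K : ProperCone ℝ (Fin d → ℝ), IsSolidPointedCone K ∧ ∀ A ∈ S, LeavesInvariant A K := by
  set s : Set (Fin d → ℝ) := {y | y = x ∨ ∃ B ∈ S, y = B *ᵥ x} with hs
  set K : ProperCone ℝ (Fin d → ℝ) := (Submodule.span {r : ℝ // 0 ≤ r} s).closure with hK
  have hmemK : ∀ y, y ∈ K ↔ y ∈ closure (Submodule.span {r : ℝ // 0 ≤ r} s : Set (Fin d → ℝ)) :=
    fun y => Iff.rfl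
  have hxK : x ∈ K := (hmemK x).2 (subset_closure (Submodule.subset_span (Or.inl rfl)))
  have hinv : ∀ A ∈ S, LeavesInvariant A K := by
    intro A hA y hy
    rw [hmemK] at hy ⊢
    have hcont : Continuous fun z : Fin d → ℝ => A *ᵥ z := by fun_prop
    refine map_mem_closure hcont hy fun z hz => ?_
    induction hz using Submodule.span_induction with
    | mem z hz =>
      refine Submodule.subset_span (Or.inr ?_)
      rcases hz with rfl | ⟨B, hB, rfl⟩
      · exact ⟨A, hA, rfl⟩
      · exact ⟨A * B, S.mul_mem hA hB, Matrix.mulVec_mulVec _ _ _⟩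
    | zero => simp
    | add z z' _ _ hz hz' => rw [Matrix.mulVec_add]; exact Submodule.add_mem _ hz hz'
    | smul c z _ hz =>
      have : A *ᵥ (c • z) = c • (A *ᵥ z) := Matrix.mulVec_smul A (c : ℝ) z
      rw [this]
      exact Submodule.smul_mem _ _ hz
  have hnonneg : ∀ y ∈ K, 0 ≤ g ⬝ᵥ y := by
    intro y hy
    rw [hmemK] at hy
    have hclosed : IsClosed {y : Fin d → ℝ | 0 ≤ g ⬝ᵥ y} :=
      isClosed_le continuous_const (by fun_prop)
    refine closure_minimal (fun z hz => ?_) hclosed hy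
    induction hz using Submodule.span_induction with
    | mem z hz =>
      rcases hz with rfl | ⟨B, hB, rfl⟩
      · exact hgx
      · exact hgS B hB
    | zero => simp
    | add z z' _ _ hz hz' =>
      rw [Set.mem_ofPred_eq, dotProduct_add]; exact add_nonneg hz hz'
    | smul c z _ hz =>
      have : g ⬝ᵥ (c • z) = (c : ℝ) * (g ⬝ᵥ z) := dotProduct_smul (c : ℝ) g z
      rw [Set.mem_ofPred_eq, this]
      exact mul_nonneg c.2 hz
  refine ⟨K, ⟨?_, ?_⟩, hinv⟩
  -- The linear span of `K` is invariant and contains `x ≠ 0`, so it is everything; a convex set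
  -- containing 0 and spanning the space has interior points.
  · have hspan : Submodule.span ℝ (K : Set (Fin d → ℝ)) = ⊤ := by
      refine (hirr _ fun A hA y hy => ?_).resolve_left fun hbot => ?_
      · have : Submodule.span ℝ (K : Set (Fin d → ℝ)) ≤
            (Submodule.span ℝ (K : Set (Fin d → ℝ))).comap A.mulVecLin :=
          Submodule.span_le.2 fun z hz => Submodule.subset_span (hinv A hA z hz)
        exact this hy
      · have : x ∈ Submodule.span ℝ (K : Set (Fin d → ℝ)) := Submodule.subset_span hxK
        rw [hbot] at this
        exact hx this
    rw [K.convex.interior_nonempty_iff_affineSpan_eq_top,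
      AffineSubspace.affineSpan_eq_top_iff_vectorSpan_eq_top_of_nonempty ℝ _ _ ⟨x, hxK⟩, eq_top_iff,
      ← hspan, Submodule.span_le]
    intro y hy
    have := vsub_mem_vectorSpan ℝ hy (zero_mem K)
    simpa using this
  -- The lineality space `K ∩ -K` is invariant too; it is not the whole space because `g` is
  -- nonnegative on `K` and negative at `-g`.
  · have hlin : (K.toPointedCone).lineal = ⊥ := by
      refine (hirr _ fun A hA y hy => ?_).resolve_right fun htop => ?_
      · refine ⟨hinv A hA y hy.1, ?_⟩
        have := hinv A hA (-y) hy.2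
        rw [Matrix.mulVec_neg] at this
        exact this
      · have hneg : -g ∈ K := by
          have : -g ∈ (K.toPointedCone).lineal := by rw [htop]; trivial
          exact this.1
        have h1 := hnonneg _ hneg
        rw [dotProduct_neg, neg_nonneg] at h1
        exact hg (dotProduct_self_eq_zero.1 (le_antisymm h1
          (Finset.sum_nonneg fun i _ => mul_self_nonneg _)))
    ext y
    constructor
    · intro hy
      have : y ∈ (K.toPointedCone).lineal := hy
      rw [hlin] at this
      exact this
    · rintro rfl
      exact ⟨zero_mem K, by simp⟩

end Cone

/-! ### Minimal rank elements and compression to dimension at most two. -/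

section Main

open Filter Topology Asymptotics Matrix

/-- The nonnegative multiples of the identity and of the elements of a matrix semigroup. -/
def nonnegMultiples {d : ℕ} (S : Subsemigroup (Matrix (Fin d) (Fin d) ℝ)) :
    Set (Matrix (Fin d) (Fin d) ℝ) :=
  {X | ∃ c : ℝ, 0 ≤ c ∧ ∃ B, (B ∈ S ∨ B = 1) ∧ X = c • B}

variable {d : ℕ} {S : Subsemigroup (Matrix (Fin d) (Fin d) ℝ)}

theorem mul_mem_closure_nonnegMultiples {X Y : Matrix (Fin d) (Fin d) ℝ}
    (hX : X ∈ closure (nonnegMultiples S)) (hY : Y ∈ closure (nonnegMultiples S)) :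
    X * Y ∈ closure (nonnegMultiples S) := by
  refine map_mem_closure₂ continuous_mul hX hY ?_
  rintro _ ⟨c, hc, B, hB, rfl⟩ _ ⟨c', hc', B', hB', rfl⟩
  refine ⟨c * c', mul_nonneg hc hc', B * B', ?_, ?_⟩
  · rcases hB with hB | rfl
    · rcases hB' with hB' | rfl
      · exact Or.inl (S.mul_mem hB hB')
      · rw [mul_one]; exact Or.inl hB
    · rw [one_mul]; exact hB'
  · rw [smul_mul_smul_comm]

theorem smul_mem_closure_nonnegMultiples {X : Matrix (Fin d) (Fin d) ℝ} {c : ℝ} (hc : 0 ≤ c)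
    (hX : X ∈ closure (nonnegMultiples S)) : c • X ∈ closure (nonnegMultiples S) := by
  refine map_mem_closure (continuous_const_smul c) hX ?_
  rintro _ ⟨c', hc', B, hB, rfl⟩
  exact ⟨c * c', mul_nonneg hc hc', B, hB, smul_smul _ _ _⟩

theorem mem_closure_nonnegMultiples {B : Matrix (Fin d) (Fin d) ℝ} (hB : B ∈ S ∨ B = 1) :
    B ∈ closure (nonnegMultiples S) :=
  subset_closure ⟨1, zero_le_one, B, hB, (one_smul _ _).symm⟩

theorem hasDominantRoot_of_mem_closure [NeZero d]
    (hcone : ∀ A ∈ S, ∃ K : ProperCone ℝ (Fin d → ℝ), IsSolidPointedCone K ∧ LeavesInvariant A K)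
    {X : Matrix (Fin d) (Fin d) ℝ} (hX : X ∈ closure (nonnegMultiples S)) : HasDominantRoot X := by
  refine closure_minimal ?_ isClosed_setOf_hasDominantRoot hX
  rintro _ ⟨c, hc, B, hB | rfl, rfl⟩
  · obtain ⟨K, hK, hBK⟩ := hcone B hB
    refine hasDominantRoot_of_leavesInvariant hK (A := c • B) fun x hx => ?_
    rw [Matrix.smul_mulVec]
    exact K.smul_mem (hBK x hx) hc
  · exact hasDominantRoot_smul_one hc

theorem exists_mem_closure_rank_le_two [NeZero d] (hirr : IsIrreducibleSemigroup S)
    (hindex : ¬ 3 ≤ semigroupExpansionIndex S) :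
    ∃ L ∈ closure (nonnegMultiples S), L ≠ 0 ∧ L.rank ≤ 2 := by
  rcases le_or_gt d 2 with hd | hd
  · refine ⟨1, mem_closure_nonnegMultiples (Or.inr rfl), one_ne_zero, ?_⟩
    simpa using hd
  -- Without an element the infimum defining the index would be the default value 0. For `d > 2` an
  -- empty semigroup leaves every line invariant, so it is not irreducible.
  · have hne : ∃ A, A ∈ S := by
      by_contra! hempty
      set e : Fin d → ℝ := fun _ => 1
      have he : e ≠ 0 := fun h => one_ne_zero (congrFun h 0)
      rcases hirr (Submodule.span ℝ {e}) (fun A hA => absurd hA (hempty A)) with h | h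
      · exact he (Submodule.span_singleton_eq_bot.1 h)
      · have h1 : Module.finrank ℝ (Submodule.span ℝ {e}) = d := by rw [h]; simp
        rw [finrank_span_singleton he] at h1
        omega
    obtain ⟨A₀, hA₀⟩ := hne
    have hmem := Nat.sInf_mem (s := {n : ℕ | ∃ A ∈ S, expansionIndex A = n}) ⟨_, A₀, hA₀, rfl⟩
    obtain ⟨A, hA, hAn⟩ := hmem
    have hA2 : expansionIndex A ≤ 2 := by
      rw [semigroupExpansionIndex, ← hAn] at hindex
      omega
    obtain ⟨L, hL, hL0, hLr⟩ := exists_mem_closure_rank_le_expansionIndex A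
    refine ⟨L, closure_mono ?_ hL, hL0, hLr.trans hA2⟩
    rintro _ ⟨c, hc, k, rfl⟩
    refine ⟨c, hc, A ^ k, ?_, rfl⟩
    rcases k with _ | k
    · exact Or.inr (pow_zero A)
    · left
      induction k with
      | zero => simpa
      | succ k ih => rw [pow_succ]; exact S.mul_mem ih hA

theorem Matrix.rank_pos_of_ne_zero {m n K : Type*} [Fintype m] [Fintype n] [Field K]
    {M : Matrix m n K} (h : M ≠ 0) : 0 < M.rank := by
  classical
  rw [Nat.pos_iff_ne_zero]
  intro h0
  have h1 : LinearMap.range M.mulVecLin = ⊥ := Submodule.finrank_eq_zero.1 h0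
  rw [LinearMap.range_eq_bot] at h1
  exact h (Matrix.toLin'.injective (by rw [Matrix.toLin'_apply', h1, map_zero]))

theorem Matrix.det_ne_zero_of_card_le_rank {n K : Type*} [Fintype n] [DecidableEq n] [Field K]
    {C : Matrix n n K} (h : Fintype.card n ≤ C.rank) : C.det ≠ 0 := by
  intro h0
  obtain ⟨v, hv, hCv⟩ := Matrix.exists_mulVec_eq_zero_iff.2 h0
  have h1 := LinearMap.finrank_range_add_finrank_ker C.mulVecLin
  rw [Module.finrank_fintype_fun_eq_card] at h1
  have h2 : Module.finrank K (LinearMap.ker C.mulVecLin) = 0 := by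
    rw [Matrix.rank] at h
    omega
  have h3 : v ∈ LinearMap.ker C.mulVecLin := hCv
  rw [Submodule.finrank_eq_zero.1 h2] at h3
  exact hv h3

/-- The compressions `F * B * E` multiply by `(F * B * E) * (F * B' * E) = F * (B * P * B') * E`.
They inherit dominant roots from `P * B`, and `E * (F * B * E) * F = P * B * P` returns them to the
closed semigroup, where minimality of `P.rank` applies. -/
theorem exists_orbit_nonneg [NeZero d]
    (hcone : ∀ A ∈ S, ∃ K : ProperCone ℝ (Fin d → ℝ), IsSolidPointedCone K ∧ LeavesInvariant A K)
    {L : Matrix (Fin d) (Fin d) ℝ} (hL : L ∈ closure (nonnegMultiples S)) (hL0 : L ≠ 0)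
    (hLr : L.rank ≤ 2) :
    ∃ x g : Fin d → ℝ, x ≠ 0 ∧ g ≠ 0 ∧
      ∀ B ∈ closure (nonnegMultiples S), 0 ≤ g ⬝ᵥ (B *ᵥ x) := by
  obtain ⟨P, ⟨hP, hP0⟩, hPmin⟩ := (measure fun P : Matrix (Fin d) (Fin d) ℝ => P.rank).wf.has_min
    {P | P ∈ closure (nonnegMultiples S) ∧ P ≠ 0} ⟨L, hL, hL0⟩
  have hPmin' : ∀ Q ∈ closure (nonnegMultiples S), Q ≠ 0 → P.rank ≤ Q.rank := fun Q hQ hQ0 =>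
    not_lt.1 (hPmin Q ⟨hQ, hQ0⟩)
  have hPpos : 0 < P.rank := Matrix.rank_pos_of_ne_zero hP0
  have hP2 : P.rank ≤ 2 := (hPmin' L hL hL0).trans hLr
  obtain ⟨E, F, E', F', hEF, hE, hF⟩ := P.exists_rank_factorization
  have hdim : P.rank = 1 ∨ P.rank = 2 := by omega
  generalize P.rank = k at *
  have : NeZero k := ⟨hPpos.ne'⟩
  set T : Set (Matrix (Fin k) (Fin k) ℝ) :=
    closure ((fun B => F * B * E) '' closure (nonnegMultiples S)) with hT
  have hTmem : ∀ B ∈ closure (nonnegMultiples S), F * B * E ∈ T := fun B hB =>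
    subset_closure ⟨B, hB, rfl⟩
  have hTmul : ∀ C ∈ T, ∀ C' ∈ T, C * C' ∈ T := by
    intro C hC C' hC'
    refine map_mem_closure₂ continuous_mul hC hC' ?_
    rintro _ ⟨B, hB, rfl⟩ _ ⟨B', hB', rfl⟩
    refine ⟨B * P * B', mul_mem_closure_nonnegMultiples (mul_mem_closure_nonnegMultiples hB hP) hB',
      ?_⟩
    simp only [hEF, Matrix.mul_assoc]
  have hTsmul : ∀ c : ℝ, 0 ≤ c → ∀ C ∈ T, c • C ∈ T := by
    intro c hc C hC
    refine map_mem_closure (continuous_const_smul c) hC ?_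
    rintro _ ⟨B, hB, rfl⟩
    exact ⟨c • B, smul_mem_closure_nonnegMultiples hc hB, by
      simp only [Matrix.mul_smul, Matrix.smul_mul]⟩
  have hTdom : ∀ C ∈ T, HasDominantRoot C := by
    intro C hC
    refine closure_minimal ?_ isClosed_setOf_hasDominantRoot hC
    rintro _ ⟨B, hB, rfl⟩
    refine HasDominantRoot.mul_comm ?_
    rw [← Matrix.mul_assoc, ← hEF]
    exact hasDominantRoot_of_mem_closure hcone (mul_mem_closure_nonnegMultiples hP hB)
  have hTlift : ∀ C ∈ T, E * C * F ∈ closure (nonnegMultiples S) := by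
    intro C hC
    have hcont : Continuous fun C : Matrix (Fin k) (Fin k) ℝ => E * C * F := by fun_prop
    have := map_mem_closure (t := closure (nonnegMultiples S)) hcont hC (by
      rintro _ ⟨B, hB, rfl⟩
      have h1 : E * (F * B * E) * F = P * B * P := by simp only [hEF, Matrix.mul_assoc]
      change E * (F * B * E) * F ∈ _
      rw [h1]
      exact mul_mem_closure_nonnegMultiples (mul_mem_closure_nonnegMultiples hP hB) hP)
    rwa [closure_closure] at this
  have hTdet : ∀ C ∈ T, C ≠ 0 → C.det ≠ 0 := by
    intro C hC hC0
    have hne : E * C * F ≠ 0 := by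
      intro h0
      apply hC0
      calc C = (E' * E) * C * (F * F') := by rw [hE, hF, Matrix.one_mul, Matrix.mul_one]
        _ = E' * (E * C * F) * F' := by simp only [Matrix.mul_assoc]
        _ = 0 := by rw [h0, Matrix.mul_zero, Matrix.zero_mul]
    refine Matrix.det_ne_zero_of_card_le_rank ?_
    rw [Fintype.card_fin]
    exact (hPmin' _ (hTlift C hC) hne).trans
      ((Matrix.rank_mul_le_left _ _).trans (Matrix.rank_mul_le_right _ _))
  obtain ⟨v, w, hv, hw, hvw⟩ : ∃ v w : Fin k → ℝ, v ≠ 0 ∧ w ≠ 0 ∧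
      ∀ C ∈ T, 0 ≤ w ⬝ᵥ (C *ᵥ v) := by
    rcases hdim with rfl | rfl
    · exact exists_dotProduct_nonneg_of_fin_one hTdom
    · exact exists_dotProduct_nonneg_of_fin_two isClosed_closure hTmul hTsmul hTdom hTdet
  refine ⟨E *ᵥ v, w ᵥ* F, fun h => hv ?_, fun h => hw ?_, fun B hB => ?_⟩
  · rw [← Matrix.one_mulVec v, ← hE, ← Matrix.mulVec_mulVec, h, Matrix.mulVec_zero]
  · rw [← Matrix.vecMul_one w, ← hF, ← Matrix.vecMul_vecMul, h, Matrix.zero_vecMul]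
  · have h1 := hvw _ (hTmem B hB)
    rwa [← Matrix.mulVec_mulVec, ← Matrix.mulVec_mulVec, Matrix.dotProduct_mulVec] at h1

end Main

theorem mainTheorem3 (d : ℕ) (S : Subsemigroup (Matrix (Fin d) (Fin d) ℝ))
    (hirr : IsIrreducibleSemigroup S)
    (hcone : ∀ A ∈ S, ∃ K : ProperCone ℝ (Fin d → ℝ),
      IsSolidPointedCone K ∧ LeavesInvariant A K)
    (hindex : ¬ 3 ≤ semigroupExpansionIndex S) :
    ∃ K : ProperCone ℝ (Fin d → ℝ),
      IsSolidPointedCone K ∧ ∀ A ∈ S, LeavesInvariant A K := by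
  rcases Nat.eq_zero_or_pos d with rfl | hd
  -- In dimension zero the zero cone is the whole space, hence solid.
  · refine ⟨⊥, ⟨⟨0, ?_⟩, ?_⟩, fun A _ x hx => ?_⟩
    · have : ((⊥ : ProperCone ℝ (Fin 0 → ℝ)) : Set (Fin 0 → ℝ)) = Set.univ :=
        Set.eq_univ_of_forall fun x => Subsingleton.elim x 0
      rw [this, interior_univ]
      trivial
    · ext x
      exact ⟨fun _ => Subsingleton.elim x 0,
        fun _ => ⟨Subsingleton.elim x 0, Subsingleton.elim (-x) 0⟩⟩
    · exact Subsingleton.elim (A.mulVec x) x ▸ hx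
  · have : NeZero d := ⟨hd.ne'⟩
    obtain ⟨L, hL, hL0, hLr⟩ := exists_mem_closure_rank_le_two hirr hindex
    obtain ⟨x, g, hx, hg, h⟩ := exists_orbit_nonneg hcone hL hL0 hLr
    refine exists_invariant_cone_of_orbit_nonneg hirr hx hg ?_ fun B hB =>
      h B (mem_closure_nonnegMultiples (Or.inl hB))
    simpa using h 1 (mem_closure_nonnegMultiples (Or.inr rfl))
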